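/- **Theorem 2.6.** Let $\alpha\in(0,1)$, $\bar\rho:=4.7476114$ and $$\theta:=\frac1{2-\alpha}+\frac{2^{1-\alpha}\alpha^2+\alpha-2\alpha^2}{2(2-\alpha)(1+\bar\rho)},\qquad q(z,y,\alpha):=2\theta(2-\alpha)+\frac{2\alpha z-\alpha z^{2-\alpha/2}}{1+z}-\frac{\alpha y^{2-\alpha/2}}{1+y}.$$ The equation $$\frac{1+\rho}{\alpha}+\rho-\rho^{2-\alpha/2}+2^{-\alpha}\alpha+\tfrac12-\alpha=0$$ has exactly one positive root $\rho=\rho^*(\alpha)$, and $\rho^*(\alpha)>\bar\rho$. Let $0=t_0<t_1<\dots<t_N$, $\tau_k:=t_k-t_{k-1}$ for $1\le k\le N$, $\rho_k:=\tau_k/\tau_{k-1}$ for $2\le k\le N$, let $\rho_{N+1}$ be a further real number, and suppose $$1\le\rho_k\le\rho^*(\alpha)\qquad(2\le k\le N+1).$$ For $1\le k\le n\le N$ put $$c^{(n)}_{n-k}:=\frac{(t_n-t_{k-1})^{1-\alpha}-(t_n-t_k)^{1-\alpha}}{\tau_k\Gamma(2-\alpha)},$$ $$d^{(n)}_{n-k}:=\frac{2\left[(t_n-t_{k-1})^{2-\alpha}-(t_n-t_k)^{2-\alpha}\right]}{\tau_k^2\Gamma(3-\alpha)}-\frac{(t_n-t_{k-1})^{1-\alpha}+(t_n-t_k)^{1-\alpha}}{\tau_k\Gamma(2-\alpha)}.$$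 For a real sequence $w^0,\dots,w^N$ with $\nabla_\tau w^k:=w^k-w^{k-1}$, the variable-step L2 approximation of the Caputo derivative of order $\alpha$ at $t_n$ is $\partial_t^\alpha w(t_n):=\sum_{k=1}^nB^{(n)}_{n-k}\nabla_\tau w^k$, where $$B^{(n)}_{n-k}:=\begin{cases}c^{(1)}_0,&k=n=1,\\ c^{(2)}_1-\frac{d^{(2)}_1}{1+\rho_2}-\frac{\rho_2^2}{1+\rho_2}d^{(2)}_0,&k=1,\ n=2,\\ c^{(n)}_0+\frac{d^{(n)}_1}{\rho_n(1+\rho_n)}+\frac{\rho_n}{1+\rho_n}d^{(n)}_0,&k=n\ge2,\\ c^{(n)}_{n-1}-\frac{d^{(n)}_{n-1}}{1+\rho_2},&k=1,\ n\ge3,\\ c^{(n)}_1+\frac{d^{(n)}_2}{\rho_{n-1}(1+\rho_{n-1})}-\frac{d^{(n)}_1}{1+\rho_n}-\frac{\rho_n^2}{1+\rho_n}d^{(n)}_0,&k=n-1,\ n\ge3,\\ c^{(n)}_{n-k}+\frac{d^{(n)}_{n-k+1}}{\rho_k(1+\rho_k)}-\frac{d^{(n)}_{n-k}}{1+\rho_{k+1}},&2\le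 k\le n-2,\ n\ge4.\end{cases}$$ Let $$\widetilde c^{(n)}_{n-k}:=\begin{cases}(1-\theta)c^{(1)}_0,&k=n=1,\\ c^{(n)}_{n-1}-\frac{1}{1+\rho_2}d^{(n)}_{n-1},&k=1,\ n\ge2,\\ (1-\theta)c^{(n)}_0+\frac{1}{\rho_n(1+\rho_n)}d^{(n)}_1,&k=n\ge2,\\ c^{(n)}_{n-k}+\frac{1}{\rho_k(1+\rho_k)}d^{(n)}_{n-k+1}-\frac{1}{1+\rho_{k+1}}d^{(n)}_{n-k},&2\le k\le n-1,\ n\ge3,\end{cases}$$ $J^{(n)}_0:=2\widetilde c^{(n)}_0$, $J^{(n)}_{n-k}:=\widetilde c^{(n)}_{n-k}$ for $1\le k\le n-1$, and for $1\le n\le N$ $$\mathcal G[\nabla_\tau w^n]:=\frac{\alpha\rho_{n+1}^{2-\alpha/2}(\nabla_\tau w^n)^2}{2(1+\rho_{n+1})\tau_n^\alpha\Gamma(3-\alpha)}+\frac12\sum_{j=1}^{n-1}\left(J^{(n)}_{n-j-1}-J^{(n)}_{n-j}\right)(w^n-w^j)^2+\frac12J^{(n)}_{n-1}(w^n-w^0)^2.$$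 Then $\mathcal G[\nabla_\tau w^n]\ge0$ for $1\le n\le N$, and for every $2\le n\le N$ $$\partial_t^\alpha w(t_n)\cdot\nabla_\tau w^n\ \ge\ \mathcal G[\nabla_\tau w^n]-\mathcal G[\nabla_\tau w^{n-1}]+\frac{q(\rho_n,\rho_{n+1},\alpha)\,(\nabla_\tau w^n)^2}{2\tau_n^\alpha\Gamma(3-\alpha)}.$$ -/

import Mathlib

namespace L2Caputo

noncomputable section

/-! The mesh is given by its nodes `t 0 < t 1 < …`. Kernels with a lower index `n - k` and an
upper index `(n)` are indexed here by the pair `n k`: for instance `cKer α t n k` is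
$c^{(n)}_{n-k}$. -/

/-- The step size $\tau_k = t_k - t_{k-1}$ (for `1 ≤ k`). -/
def tau (t : ℕ → ℝ) (k : ℕ) : ℝ := t k - t (k - 1)

/-- The step ratios: $\rho_1 = 0$ and $\rho_k = \tau_k / \tau_{k-1}$ for `2 ≤ k`. -/
def rho (t : ℕ → ℝ) (k : ℕ) : ℝ := if k ≤ 1 then 0 else tau t k / tau t (k - 1)

/-- The backward difference $\nabla_\tau w^k = w^k - w^{k-1}$ (for `1 ≤ k`). -/
def nabla (w : ℕ → ℝ) (k : ℕ) : ℝ := w k - w (k - 1)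

/-- The numerical constant $\bar\rho$. -/
def rhoBar : ℝ := 4.7476114

/-- The splitting parameter $\theta$. -/
def theta (α : ℝ) : ℝ :=
  1 / (2 - α) +
    ((2 : ℝ) ^ (1 - α) * α ^ 2 + α - 2 * α ^ 2) / (2 * (2 - α) * (1 + rhoBar))

/-- $c^{(n)}_{n-k}$, for `1 ≤ k ≤ n`. -/
def cKer (α : ℝ) (t : ℕ → ℝ) (n k : ℕ) : ℝ :=
  ((t n - t (k - 1)) ^ (1 - α) - (t n - t k) ^ (1 - α)) / (tau t k * Real.Gamma (2 - α))

/-- $d^{(n)}_{n-k}$, for `1 ≤ k ≤ n`. -/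
def dKer (α : ℝ) (t : ℕ → ℝ) (n k : ℕ) : ℝ :=
  2 * ((t n - t (k - 1)) ^ (2 - α) - (t n - t k) ^ (2 - α)) /
      (tau t k ^ 2 * Real.Gamma (3 - α)) -
    ((t n - t (k - 1)) ^ (1 - α) + (t n - t k) ^ (1 - α)) / (tau t k * Real.Gamma (2 - α))

/-- The discrete L2 kernels $B^{(n)}_{n-k}$, for `1 ≤ k ≤ n`. -/
def BKer (α : ℝ) (t : ℕ → ℝ) (n k : ℕ) : ℝ :=
  if n = 1 then cKer α t 1 1
  else if k = n then
    cKer α t n n + dKer α t n (n - 1) / (rho t n * (1 + rho t n)) +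
      rho t n / (1 + rho t n) * dKer α t n n
  else if n = 2 then
    cKer α t 2 1 - dKer α t 2 1 / (1 + rho t 2) -
      rho t 2 ^ 2 / (1 + rho t 2) * dKer α t 2 2
  else if k = 1 then
    cKer α t n 1 - dKer α t n 1 / (1 + rho t 2)
  else if k = n - 1 then
    cKer α t n (n - 1) + dKer α t n (n - 2) / (rho t (n - 1) * (1 + rho t (n - 1))) -
      dKer α t n (n - 1) / (1 + rho t n) - rho t n ^ 2 / (1 + rho t n) * dKer α t n n
  else
    cKer α t n k + dKer α t n (k - 1) / (rho t k * (1 + rho t k)) -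
      dKer α t n k / (1 + rho t (k + 1))

/-- The variable-step L2 approximation $\sum_{k=1}^n B^{(n)}_{n-k} \nabla_\tau w^k$ of the Caputo
derivative of order `α` at $t_n$. -/
def caputoL2 (α : ℝ) (t : ℕ → ℝ) (w : ℕ → ℝ) (n : ℕ) : ℝ :=
  ∑ k ∈ Finset.Icc 1 n, BKer α t n k * nabla w k

/-- The modified kernels $\tilde c^{(n)}_{n-k}$, for `1 ≤ k ≤ n`. -/
def cTilde (α : ℝ) (t : ℕ → ℝ) (n k : ℕ) : ℝ :=
  if n = 1 then (1 - theta α) * cKer α t 1 1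
  else if k = 1 then
    cKer α t n 1 - 1 / (1 + rho t 2) * dKer α t n 1
  else if k = n then
    (1 - theta α) * cKer α t n n + 1 / (rho t n * (1 + rho t n)) * dKer α t n (n - 1)
  else
    cKer α t n k + 1 / (rho t k * (1 + rho t k)) * dKer α t n (k - 1) -
      1 / (1 + rho t (k + 1)) * dKer α t n k

/-- The auxiliary kernels $J^{(n)}_{n-k}$: $J^{(n)}_0 = 2\tilde c^{(n)}_0$ and
$J^{(n)}_{n-k} = \tilde c^{(n)}_{n-k}$ for `1 ≤ k ≤ n - 1`. -/
def JKer (α : ℝ) (t : ℕ → ℝ) (n k : ℕ) : ℝ :=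
  if k = n then 2 * cTilde α t n n else cTilde α t n k

/-- The functional $\mathcal G[\nabla_\tau w^n]$, for `1 ≤ n`. -/
def G (α : ℝ) (t : ℕ → ℝ) (w : ℕ → ℝ) (n : ℕ) : ℝ :=
  α * rho t (n + 1) ^ (2 - α / 2) * nabla w n ^ 2 /
      (2 * (1 + rho t (n + 1)) * tau t n ^ α * Real.Gamma (3 - α)) +
    1 / 2 * ∑ j ∈ Finset.Icc 1 (n - 1),
      (JKer α t n (j + 1) - JKer α t n j) * (w n - w j) ^ 2 +
    1 / 2 * JKer α t n 1 * (w n - w 0) ^ 2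

/-- The function $q(z, y, \alpha)$. -/
def q (z y α : ℝ) : ℝ :=
  2 * theta α * (2 - α) + (2 * α * z - α * z ^ (2 - α / 2)) / (1 + z) -
    α * y ^ (2 - α / 2) / (1 + y)

/-- The function whose positive root is $\rho^*(\alpha)$. -/
def rootFun (r α : ℝ) : ℝ :=
  (1 + r) / α + r - r ^ (2 - α / 2) + (2 : ℝ) ^ (-α) * α + 1 / 2 - α

/-- The upper bound $\rho^*(\alpha)$: the positive root of `rootFun · α` (the theorem includes the
assertion that there is exactly one). -/
def rhoStar (α : ℝ) : ℝ := sSup {r : ℝ | 0 < r ∧ rootFun r α = 0}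

end

end L2Caputo

open L2Caputo

/-! Up to the factor $1/\Gamma(1-\alpha)$, $c^{(n)}_{n-k}$ is the mean over $[t_{k-1},t_k]$ of the
kernel $s\mapsto(t_n-s)^{-\alpha}$, and $d^{(n)}_{n-k}$ is its normalised first moment about the
midpoint. So, away from the diagonal, $\widetilde c^{(n)}_{n-k}$ is a fixed functional on that
interval and the preceding one. For an increasing convex $\varphi$, on a mesh whose steps do not
decrease, its value lies between $\varphi(t_{k-1})$ and $\varphi(t_k)$ (`le_localFunctional`,
`localFunctional_le`).

These bounds, for the kernel itself and for the difference of the kernels of two time levels (again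
nonnegative, increasing and convex), order the kernels $J$: they are nonnegative, increase in $k$,
and their increments in $k$ decrease in $n$ (`JKer_le_succ`, `JKer_one_le`, `JKer_succ_sub_le`). The
diagonal entry needs the lower bound `le_leadCoeff` on $1-\theta$. Summation by parts then bounds
the $\widetilde c$ part of the derivative, times $\nabla_\tau w^n$, below by a difference of
energies (`kernelEnergy_sub_le`).

What remains of $B$ is a square and a product of two consecutive differences; Young's inequality
splits the latter so that one half telescopes through the first term of `G` and the other enters
`q`.

The root is unique because the function is concave in $\rho$ and positive at $0$. It exceeds
$\bar\rho$ because the function is still positive at $\bar\rho$, by less than $10^{-7}$ for the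
worst $\alpha$; this is a quantitative convexity argument in $\alpha$. -/

/-! ### Monotonicity and convexity of singular kernels and their differences -/

/-- The function `s ↦ (x - s)^(-p) - c (y - s)^(-p)`: a singular kernel for `c = 0`, a difference
of two such kernels for `c = 1`. -/
noncomputable def powDiff (c x y p s : ℝ) : ℝ := (x - s) ^ (-p) - c * (y - s) ^ (-p)

lemma powDiff_nonneg {c x y p s : ℝ} (hc1 : c ≤ 1) (hxy : x ≤ y) (hp : 0 ≤ p) (hs : s < x) :
    0 ≤ powDiff c x y p s := by
  have h1 : 0 < x - s := sub_pos.2 hs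
  have h2 : (y - s) ^ (-p) ≤ (x - s) ^ (-p) :=
    Real.rpow_le_rpow_of_nonpos h1 (by linarith) (by linarith)
  have h3 : 0 ≤ (y - s) ^ (-p) := Real.rpow_nonneg (by linarith) _
  unfold powDiff
  nlinarith

/-- Differentiation stays in the family, with $p$ raised by one. Nonnegativity for every $p\ge0$
therefore yields monotonicity, and monotonicity yields convexity. -/
lemma hasDerivAt_powDiff {c x y p s : ℝ} (hxy : x ≤ y) (hs : s < x) :
    HasDerivAt (powDiff c x y p) (p * powDiff c x y (p + 1) s) s := by
  have key : ∀ z : ℝ, s < z →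
      HasDerivAt (fun s => (z - s) ^ (-p)) (p * (z - s) ^ (-(p + 1))) s := by
    intro z hz
    have h := ((hasDerivAt_id s).const_sub z).rpow_const (p := -p)
      (Or.inl (by simpa using (sub_pos.2 hz).ne'))
    refine h.congr_deriv ?_
    rw [show -(p + 1) = -p - 1 by ring, id]
    ring
  have h := (key x hs).sub ((key y (hs.trans_le hxy)).const_mul c)
  refine HasDerivAt.congr_deriv (f := powDiff c x y p) h ?_
  unfold powDiff
  ring

lemma continuousOn_powDiff {c x y p : ℝ} (hxy : x ≤ y) :
    ContinuousOn (powDiff c x y p) (Set.Iio x) :=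
  fun _ hs => (hasDerivAt_powDiff hxy hs).continuousAt.continuousWithinAt

lemma monotoneOn_powDiff {c x y p : ℝ} (hc1 : c ≤ 1) (hxy : x ≤ y) (hp : 0 ≤ p) :
    MonotoneOn (powDiff c x y p) (Set.Iio x) := by
  refine monotoneOn_of_deriv_nonneg (convex_Iio x) (continuousOn_powDiff hxy) ?_ ?_
  · intro s hs
    rw [interior_Iio] at hs
    exact (hasDerivAt_powDiff hxy hs).differentiableAt.differentiableWithinAt
  · intro s hs
    rw [interior_Iio] at hs
    rw [(hasDerivAt_powDiff hxy hs).deriv]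
    exact mul_nonneg hp (powDiff_nonneg hc1 hxy (by linarith) hs)

lemma convexOn_powDiff {c x y p : ℝ} (hc1 : c ≤ 1) (hxy : x ≤ y) (hp : 0 ≤ p) :
    ConvexOn ℝ (Set.Iio x) (powDiff c x y p) := by
  refine MonotoneOn.convexOn_of_deriv (convex_Iio x) (continuousOn_powDiff hxy) ?_ ?_
  · intro s hs
    rw [interior_Iio] at hs
    exact (hasDerivAt_powDiff hxy hs).differentiableAt.differentiableWithinAt
  · rw [interior_Iio]
    intro s hs s' hs' hss'
    rw [(hasDerivAt_powDiff hxy hs).deriv, (hasDerivAt_powDiff hxy hs').deriv]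
    exact mul_le_mul_of_nonneg_left
      (monotoneOn_powDiff hc1 hxy (by linarith : 0 ≤ p + 1) hs hs' hss') hp

/-! ### Mean and first moment on an interval -/

/-- The mean value of `φ` over `[a, b]`. -/
noncomputable def avg (φ : ℝ → ℝ) (a b : ℝ) : ℝ := (b - a)⁻¹ * ∫ s in a..b, φ s

/-- The normalised first moment of `φ` over `[a, b]` about the midpoint. -/
noncomputable def skew (φ : ℝ → ℝ) (a b : ℝ) : ℝ :=
  2 / (b - a) ^ 2 * ∫ s in a..b, (s - (a + b) / 2) * φ s

section functionals

variable {φ ψ : ℝ → ℝ} {a b : ℝ}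

lemma avg_sub (hφ : IntervalIntegrable φ MeasureTheory.volume a b)
    (hψ : IntervalIntegrable ψ MeasureTheory.volume a b) :
    avg (fun s => φ s - ψ s) a b = avg φ a b - avg ψ a b := by
  unfold avg
  rw [intervalIntegral.integral_sub hφ hψ, mul_sub]

lemma skew_sub (hφ : IntervalIntegrable φ MeasureTheory.volume a b)
    (hψ : IntervalIntegrable ψ MeasureTheory.volume a b) :
    skew (fun s => φ s - ψ s) a b = skew φ a b - skew ψ a b := by
  unfold skew
  simp only [mul_sub]
  rw [intervalIntegral.integral_sub, mul_sub]
  · exact hφ.continuousOn_mul (by fun_prop)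
  · exact hψ.continuousOn_mul (by fun_prop)

lemma integral_sub_midpoint_mul_const (a b C : ℝ) :
    ∫ s in a..b, (s - (a + b) / 2) * C = 0 := by
  rw [intervalIntegral.integral_mul_const, intervalIntegral.integral_sub (by simp) (by simp),
    integral_id, intervalIntegral.integral_const, smul_eq_mul]
  ring

lemma integral_sub_left (a b : ℝ) : ∫ s in a..b, (s - a) = (b - a) ^ 2 / 2 := by
  rw [intervalIntegral.integral_sub (by simp) (by simp), integral_id,
    intervalIntegral.integral_const, smul_eq_mul]
  ring

lemma skew_nonneg (hab : a < b) (hc : ContinuousOn φ (Set.Icc a b))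
    (hm : MonotoneOn φ (Set.Icc a b)) : 0 ≤ skew φ a b := by
  have hmid : (a + b) / 2 ∈ Set.Icc a b := ⟨by linarith, by linarith⟩
  refine mul_nonneg (by positivity) ?_
  -- Constants have zero first moment, so $\varphi$ may be compared with its midpoint value.
  rw [← integral_sub_midpoint_mul_const a b (φ ((a + b) / 2))]
  refine intervalIntegral.integral_mono_on hab.le ?_ ?_ fun s hs => ?_
  · exact Continuous.intervalIntegrable (by fun_prop) _ _
  · refine ContinuousOn.intervalIntegrable ?_
    rw [Set.uIcc_of_le hab.le]
    fun_prop
  · rcases le_total s ((a + b) / 2) with h | h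
    · exact mul_le_mul_of_nonpos_left (hm hs hmid h) (by linarith)
    · exact mul_le_mul_of_nonneg_left (hm hmid hs h) (by linarith)

lemma skew_le (hab : a < b) (hc : ContinuousOn φ (Set.Icc a b))
    (hm : MonotoneOn φ (Set.Icc a b)) : skew φ a b ≤ φ b - φ a := by
  have ha : a ∈ Set.Icc a b := ⟨le_rfl, hab.le⟩
  have hb : b ∈ Set.Icc a b := ⟨hab.le, le_rfl⟩
  have h0 : 0 < b - a := sub_pos.2 hab
  have h : ∫ s in a..b, (s - (a + b) / 2) * φ s ≤
      ∫ s in a..b, ((s - (a + b) / 2) * φ a + (b - a) / 2 * (φ b - φ a)) := by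
    refine intervalIntegral.integral_mono_on hab.le ?_ ?_ fun s hs => ?_
    · refine ContinuousOn.intervalIntegrable ?_
      rw [Set.uIcc_of_le hab.le]
      fun_prop
    · exact Continuous.intervalIntegrable (by fun_prop) _ _
    · have h1 := hm ha hs hs.1
      have h2 := hm hs hb hs.2
      have h3 := hs.2
      nlinarith [mul_nonneg (sub_nonneg.2 h3) (sub_nonneg.2 h1),
        mul_nonneg h0.le (sub_nonneg.2 h2)]
  rw [intervalIntegral.integral_add (Continuous.intervalIntegrable (by fun_prop) _ _) (by simp),
    integral_sub_midpoint_mul_const, intervalIntegral.integral_const, smul_eq_mul, zero_add] at h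
  unfold skew
  calc _ ≤ 2 / (b - a) ^ 2 * ((b - a) * ((b - a) / 2 * (φ b - φ a))) :=
        mul_le_mul_of_nonneg_left h (by positivity)
    _ = φ b - φ a := by field_simp

lemma avg_le (hab : a < b) (hc : ContinuousOn φ (Set.Icc a b))
    (hcv : ConvexOn ℝ (Set.Icc a b) φ) : avg φ a b ≤ (φ a + φ b) / 2 := by
  have ha : a ∈ Set.Icc a b := ⟨le_rfl, hab.le⟩
  have hb : b ∈ Set.Icc a b := ⟨hab.le, le_rfl⟩
  have h0 : 0 < b - a := sub_pos.2 hab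
  have h : ∫ s in a..b, φ s ≤ ∫ s in a..b, (φ a + (s - a) * ((φ b - φ a) / (b - a))) := by
    refine intervalIntegral.integral_mono_on hab.le ?_ ?_ fun s hs => ?_
    · refine ContinuousOn.intervalIntegrable ?_
      rwa [Set.uIcc_of_le hab.le]
    · exact Continuous.intervalIntegrable (by fun_prop) _ _
    · have h1 := hcv.2 ha hb
        (div_nonneg (by linarith [hs.2]) h0.le : 0 ≤ (b - s) / (b - a))
        (div_nonneg (by linarith [hs.1]) h0.le : 0 ≤ (s - a) / (b - a))
        (by field_simp; ring)
      simp only [smul_eq_mul] at h1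
      rw [show (b - s) / (b - a) * a + (s - a) / (b - a) * b = s by field_simp; ring] at h1
      refine h1.trans (le_of_eq ?_)
      field_simp
      ring
  rw [intervalIntegral.integral_add (by simp) (Continuous.intervalIntegrable (by fun_prop) _ _),
    intervalIntegral.integral_mul_const, integral_sub_left, intervalIntegral.integral_const,
    smul_eq_mul] at h
  unfold avg
  calc _ ≤ (b - a)⁻¹ * ((b - a) * φ a + (b - a) ^ 2 / 2 * ((φ b - φ a) / (b - a))) :=
        mul_le_mul_of_nonneg_left h (by positivity)
    _ = _ := by field_simp; ring

/-- The combination integrates $\varphi$ against a multiple of $(b-a)-(s-\frac{a+b}2)$, a positive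
weight of total mass one after normalisation. -/
lemma le_avg_sub_skew (hab : a < b) (hc : ContinuousOn φ (Set.Icc a b))
    (hm : MonotoneOn φ (Set.Icc a b)) : φ a ≤ avg φ a b - skew φ a b / 2 := by
  have ha : a ∈ Set.Icc a b := ⟨le_rfl, hab.le⟩
  have h0 : 0 < b - a := sub_pos.2 hab
  have hi : IntervalIntegrable φ MeasureTheory.volume a b := by
    refine ContinuousOn.intervalIntegrable ?_
    rwa [Set.uIcc_of_le hab.le]
  have hi' : IntervalIntegrable (fun s => (s - (a + b) / 2) * φ s) MeasureTheory.volume a b :=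
    hi.continuousOn_mul (by fun_prop)
  have h : ∫ s in a..b, ((b - a) * φ a - (s - (a + b) / 2) * φ a) ≤
      ∫ s in a..b, ((b - a) * φ s - (s - (a + b) / 2) * φ s) := by
    refine intervalIntegral.integral_mono_on hab.le
      (Continuous.intervalIntegrable (by fun_prop) _ _) ((hi.const_mul _).sub hi') fun s hs => ?_
    have h1 := hm ha hs hs.1
    nlinarith [mul_nonneg (sub_nonneg.2 h1) (by linarith [hs.2] : 0 ≤ b - a - (s - (a + b) / 2))]
  rw [intervalIntegral.integral_sub (by simp) (Continuous.intervalIntegrable (by fun_prop) _ _),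
    intervalIntegral.integral_sub (hi.const_mul _) hi', integral_sub_midpoint_mul_const,
    intervalIntegral.integral_const, intervalIntegral.integral_const_mul, smul_eq_mul] at h
  unfold avg skew
  generalize (∫ s in a..b, φ s) = I at h ⊢
  generalize (∫ s in a..b, (s - (a + b) / 2) * φ s) = I' at h ⊢
  calc φ a = ((b - a) ^ 2)⁻¹ * ((b - a) * ((b - a) * φ a) - 0) := by field_simp; ring
    _ ≤ _ := mul_le_mul_of_nonneg_left h (by positivity)
    _ = _ := by field_simp

end functionals

/-- `cKer` as a mean value of the singular kernel. -/
lemma avg_kernel {α x a b : ℝ} (hα1 : α < 1) :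
    avg (fun s => (x - s) ^ (-α)) a b =
      ((x - a) ^ (1 - α) - (x - b) ^ (1 - α)) / ((b - a) * (1 - α)) := by
  unfold avg
  rw [intervalIntegral.integral_comp_sub_left (fun u => u ^ (-α)) x,
    integral_rpow (Or.inl (by linarith)), show -α + 1 = 1 - α by ring]
  rw [← div_eq_inv_mul, div_div, mul_comm (1 - α)]

/-- `dKer` as a first moment of the singular kernel. -/
lemma skew_kernel {α x a b : ℝ} (hα1 : α < 1) (hab : a < b) (hbx : b ≤ x) :
    skew (fun s => (x - s) ^ (-α)) a b =
      2 * ((x - a) ^ (2 - α) - (x - b) ^ (2 - α)) / ((b - a) ^ 2 * ((2 - α) * (1 - α))) -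
        ((x - a) ^ (1 - α) + (x - b) ^ (1 - α)) / ((b - a) * (1 - α)) := by
  have h0 : 0 < b - a := sub_pos.2 hab
  have h1 : 0 < 1 - α := by linarith
  have h2 : 0 < 2 - α := by linarith
  have hpow : ∀ u : ℝ, 0 ≤ u → u ^ (2 - α) = u * u ^ (1 - α) := by
    intro u hu
    rw [show 2 - α = 1 + (1 - α) by ring, Real.rpow_add_of_nonneg hu (by norm_num) h1.le,
      Real.rpow_one]
  have hpow' : ∀ u : ℝ, 0 ≤ u → u ≠ 0 → u ^ (1 - α) = u * u ^ (-α) := by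
    intro u hu hu0
    rw [show 1 - α = 1 + -α by ring, Real.rpow_add (lt_of_le_of_ne hu (Ne.symm hu0)),
      Real.rpow_one]
  have hint : ∫ s in a..b, (s - (a + b) / 2) * (x - s) ^ (-α) =
      ∫ u in (x - b)..(x - a), ((x - (a + b) / 2) * u ^ (-α) - u ^ (1 - α)) := by
    rw [← intervalIntegral.integral_comp_sub_left
      (fun u => (x - (a + b) / 2) * u ^ (-α) - u ^ (1 - α)) x]
    -- The case $b=x$ is allowed; the singular point $s=x$ is a null set.
    refine intervalIntegral.integral_congr_ae ?_
    have hne : ∀ᵐ s : ℝ, s ≠ x := by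
      simp [MeasureTheory.ae_iff]
    filter_upwards [hne] with s hs hsI
    rw [Set.uIoc_of_le hab.le] at hsI
    rw [hpow' (x - s) (by linarith [hsI.2]) (sub_ne_zero.2 hs.symm)]
    ring
  unfold skew
  rw [hint, intervalIntegral.integral_sub
    ((intervalIntegral.intervalIntegrable_rpow' (by linarith)).const_mul _)
    (intervalIntegral.intervalIntegrable_rpow' (by linarith)),
    intervalIntegral.integral_const_mul, integral_rpow (Or.inl (by linarith)),
    integral_rpow (Or.inl (by linarith)), show -α + 1 = 1 - α by ring,
    show 1 - α + 1 = 2 - α by ring, hpow (x - a) (by linarith), hpow (x - b) (by linarith)]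
  generalize (x - a) ^ (1 - α) = A
  generalize (x - b) ^ (1 - α) = B
  field_simp
  ring

/-! ### Meshes with nondecreasing steps and the local functional -/

/-- A strictly increasing mesh with nodes up to `t N` whose step sizes do not decrease. -/
structure CoarseningMesh (t : ℕ → ℝ) (N : ℕ) : Prop where
  lt_succ : ∀ k < N, t k < t (k + 1)
  one_le_rho : ∀ k, 2 ≤ k → k ≤ N → 1 ≤ rho t k

namespace CoarseningMesh

variable {t : ℕ → ℝ} {N : ℕ}

lemma lt (h : CoarseningMesh t N) {i j : ℕ} (hij : i < j) (hj : j ≤ N) : t i < t j := by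
  induction j, hij using Nat.le_induction with
  | base => exact h.lt_succ i hj
  | succ m hm ih => exact (ih (by omega)).trans (h.lt_succ m hj)

lemma tau_pos (h : CoarseningMesh t N) {k : ℕ} (hk : 1 ≤ k) (hkN : k ≤ N) : 0 < tau t k :=
  sub_pos.2 (h.lt (by omega) hkN)

lemma tau_eq (h : CoarseningMesh t N) {k : ℕ} (hk : 2 ≤ k) (hkN : k ≤ N) :
    tau t k = rho t k * tau t (k - 1) := by
  have := h.tau_pos (k := k - 1) (by omega) (by omega)
  rw [rho, if_neg (by omega), div_mul_cancel₀ _ this.ne']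

lemma tau_le (h : CoarseningMesh t N) {k : ℕ} (hk : 2 ≤ k) (hkN : k ≤ N) :
    tau t (k - 1) ≤ tau t k := by
  rw [h.tau_eq hk hkN]
  exact le_mul_of_one_le_left (h.tau_pos (by omega) (by omega)).le (h.one_le_rho k hk hkN)

end CoarseningMesh

/-- The quadrature functional on `[t (k - 1), t k]` by which a modified kernel acts on the singular
kernel of the Caputo derivative. -/
noncomputable def localFunctional (t : ℕ → ℝ) (φ : ℝ → ℝ) (k : ℕ) : ℝ :=
  avg φ (t (k - 1)) (t k) +
    (if k = 1 then 0
      else 1 / (rho t k * (1 + rho t k)) * skew φ (t (k - 1 - 1)) (t (k - 1))) -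
    1 / (1 + rho t (k + 1)) * skew φ (t (k - 1)) (t k)

section localFunctional

variable {t : ℕ → ℝ} {N k : ℕ} {x : ℝ} {φ : ℝ → ℝ}

/-- The negative moment has weight at most $1/2$ since $\rho_{k+1}\ge1$, so `le_avg_sub_skew`
absorbs it; the moment from the preceding interval only helps. -/
lemma le_localFunctional (h : CoarseningMesh t N) (hk : 1 ≤ k) (hkN : k + 1 ≤ N) (hx : t k < x)
    (hc : ContinuousOn φ (Set.Iio x)) (hm : MonotoneOn φ (Set.Iio x)) :
    φ (t (k - 1)) ≤ localFunctional t φ k := by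
  have hlt : t (k - 1) < t k := h.lt (by omega) (by omega)
  have hsub : Set.Icc (t (k - 1)) (t k) ⊆ Set.Iio x := fun s hs => hs.2.trans_lt hx
  have h1 := le_avg_sub_skew hlt (hc.mono hsub) (hm.mono hsub)
  have h2 := skew_nonneg hlt (hc.mono hsub) (hm.mono hsub)
  have hz := h.one_le_rho (k + 1) (by omega) hkN
  have h3 : 1 / (1 + rho t (k + 1)) * skew φ (t (k - 1)) (t k) ≤
      1 / 2 * skew φ (t (k - 1)) (t k) :=
    mul_le_mul_of_nonneg_right (one_div_le_one_div_of_le (by norm_num) (by linarith)) h2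
  have h4 : 0 ≤ if k = 1 then 0
      else 1 / (rho t k * (1 + rho t k)) * skew φ (t (k - 1 - 1)) (t (k - 1)) := by
    split_ifs with hk1
    · exact le_rfl
    · have hy := h.one_le_rho k (by omega) (by omega)
      have hsub' : Set.Icc (t (k - 1 - 1)) (t (k - 1)) ⊆ Set.Iio x :=
        fun s hs => hs.2.trans_lt (hlt.trans hx)
      have := skew_nonneg (h.lt (by omega) (by omega)) (hc.mono hsub') (hm.mono hsub')
      positivity
  unfold localFunctional
  linarith

/-- By convexity the mean is at most the trapezoidal value. The preceding moment has weight at most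
$1/2$ and is at most the increment of $\varphi$ over its interval, which by convexity and
$\tau_{k-1}\le\tau_k$ does not exceed the increment over the current one. The two halves add up to
$\varphi(t_k)$. -/
lemma localFunctional_le (h : CoarseningMesh t N) (hk : 1 ≤ k) (hkN : k + 1 ≤ N) (hx : t k < x)
    (hc : ContinuousOn φ (Set.Iio x)) (hm : MonotoneOn φ (Set.Iio x))
    (hcv : ConvexOn ℝ (Set.Iio x) φ) :
    localFunctional t φ k ≤ φ (t k) := by
  have hlt : t (k - 1) < t k := h.lt (by omega) (by omega)
  have hsub : Set.Icc (t (k - 1)) (t k) ⊆ Set.Iio x := fun s hs => hs.2.trans_lt hx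
  have h1 := avg_le hlt (hc.mono hsub) (hcv.subset hsub (convex_Icc _ _))
  have h2 := skew_nonneg hlt (hc.mono hsub) (hm.mono hsub)
  have hz := h.one_le_rho (k + 1) (by omega) hkN
  have h3 : 0 ≤ 1 / (1 + rho t (k + 1)) * skew φ (t (k - 1)) (t k) := by positivity
  have h4 : (if k = 1 then 0
      else 1 / (rho t k * (1 + rho t k)) * skew φ (t (k - 1 - 1)) (t (k - 1))) ≤
      (φ (t k) - φ (t (k - 1))) / 2 := by
    split_ifs with hk1
    · linarith [hm (hlt.trans hx) hx hlt.le]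
    · have hy := h.one_le_rho k (by omega) (by omega)
      have hlt' : t (k - 1 - 1) < t (k - 1) := h.lt (by omega) (by omega)
      have hsub' : Set.Icc (t (k - 1 - 1)) (t (k - 1)) ⊆ Set.Iio x :=
        fun s hs => hs.2.trans_lt (hlt.trans hx)
      have h5 := skew_nonneg hlt' (hc.mono hsub') (hm.mono hsub')
      have h6 := skew_le hlt' (hc.mono hsub') (hm.mono hsub')
      have h7 := hcv.slope_mono_adjacent (hlt'.trans (hlt.trans hx)) hx hlt' hlt
      have h8 : φ (t (k - 1)) - φ (t (k - 1 - 1)) ≤ φ (t k) - φ (t (k - 1)) := by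
        have ht := h.tau_le (k := k) (by omega) (by omega)
        unfold tau at ht
        rw [div_le_div_iff₀ (by linarith) (by linarith)] at h7
        have h9 := hm (hlt.trans hx) hx hlt.le
        have h10 : (φ (t k) - φ (t (k - 1))) * (t (k - 1) - t (k - 1 - 1)) ≤
            (φ (t k) - φ (t (k - 1))) * (t k - t (k - 1)) :=
          mul_le_mul_of_nonneg_left ht (by linarith)
        exact le_of_mul_le_mul_right (h7.trans h10) (by linarith)
      have h11 : 1 / (rho t k * (1 + rho t k)) * skew φ (t (k - 1 - 1)) (t (k - 1)) ≤
          1 / 2 * skew φ (t (k - 1 - 1)) (t (k - 1)) :=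
        mul_le_mul_of_nonneg_right
          (one_div_le_one_div_of_le (by norm_num) (by nlinarith)) h5
      linarith
  unfold localFunctional
  linarith

lemma localFunctional_sub {ψ : ℝ → ℝ} (h : CoarseningMesh t N) (hk : 1 ≤ k) (hkN : k ≤ N)
    (hx : t k < x) (hφ : ContinuousOn φ (Set.Iio x)) (hψ : ContinuousOn ψ (Set.Iio x)) :
    localFunctional t (fun s => φ s - ψ s) k = localFunctional t φ k - localFunctional t ψ k := by
  have hint : ∀ {f : ℝ → ℝ} {i j : ℕ}, ContinuousOn f (Set.Iio x) → i ≤ k → j ≤ k →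
      IntervalIntegrable f MeasureTheory.volume (t i) (t j) := by
    intro f i j hf hi hj
    refine (hf.mono fun s hs => ?_).intervalIntegrable
    have hmono : ∀ {i : ℕ}, i ≤ k → t i ≤ t k := fun {i} hi => by
      rcases hi.lt_or_eq with h' | h'
      · exact (h.lt h' hkN).le
      · rw [h']
    exact (hs.2.trans (max_le (hmono hi) (hmono hj))).trans_lt hx
  unfold localFunctional
  rw [avg_sub (hint hφ (by omega) (by omega)) (hint hψ (by omega) (by omega)),
    skew_sub (hint hφ (by omega) (by omega)) (hint hψ (by omega) (by omega)),
    skew_sub (hint hφ (by omega) (by omega)) (hint hψ (by omega) (by omega))]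
  split_ifs <;> ring

end localFunctional

/-! ### The discrete kernels as functionals of the singular kernel -/

/-- The kernel `s ↦ (x - s)^(-α)`. -/
noncomputable def sKer (α x s : ℝ) : ℝ := (x - s) ^ (-α)

section sKer

variable {α x y : ℝ}

lemma sKer_eq_powDiff : sKer α x = powDiff 0 x x α := by
  funext s
  simp [sKer, powDiff]

lemma sKer_sub_eq_powDiff : (fun s => sKer α x s - sKer α y s) = powDiff 1 x y α := by
  funext s
  simp [sKer, powDiff]

lemma continuousOn_sKer : ContinuousOn (sKer α x) (Set.Iio x) :=
  sKer_eq_powDiff ▸ continuousOn_powDiff le_rfl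

lemma monotoneOn_sKer (hα : 0 ≤ α) : MonotoneOn (sKer α x) (Set.Iio x) :=
  sKer_eq_powDiff ▸ monotoneOn_powDiff zero_le_one le_rfl hα

lemma convexOn_sKer (hα : 0 ≤ α) : ConvexOn ℝ (Set.Iio x) (sKer α x) :=
  sKer_eq_powDiff ▸ convexOn_powDiff zero_le_one le_rfl hα

end sKer

section kernels

variable {α : ℝ} {t : ℕ → ℝ} {N n k : ℕ}

lemma Gamma_two_sub (hα1 : α < 1) :
    Real.Gamma (2 - α) = (1 - α) * Real.Gamma (1 - α) := by
  rw [show 2 - α = (1 - α) + 1 by ring, Real.Gamma_add_one (by linarith)]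

lemma Gamma_three_sub (hα1 : α < 1) :
    Real.Gamma (3 - α) = (2 - α) * ((1 - α) * Real.Gamma (1 - α)) := by
  rw [← Gamma_two_sub hα1, show 3 - α = (2 - α) + 1 by ring, Real.Gamma_add_one (by linarith)]

lemma cKer_eq (hα1 : α < 1) :
    cKer α t n k = avg (sKer α (t n)) (t (k - 1)) (t k) / Real.Gamma (1 - α) := by
  unfold cKer sKer
  rw [avg_kernel hα1, Gamma_two_sub hα1, tau, div_div, mul_assoc]

lemma dKer_eq (hα1 : α < 1) (h : CoarseningMesh t N) (hk : 1 ≤ k) (hkn : k ≤ n) (hn : n ≤ N) :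
    dKer α t n k = skew (sKer α (t n)) (t (k - 1)) (t k) / Real.Gamma (1 - α) := by
  have hle : t k ≤ t n := by
    rcases hkn.lt_or_eq with h' | h'
    · exact (h.lt h' hn).le
    · rw [h']
  unfold dKer sKer
  rw [skew_kernel hα1 (h.lt (by omega) (by omega)) hle, Gamma_two_sub hα1, Gamma_three_sub hα1,
    tau, sub_div, div_div, div_div]
  ring_nf

lemma cKer_self (hα1 : α < 1) (h : CoarseningMesh t N) (hn1 : 1 ≤ n) (hn : n ≤ N) :
    cKer α t n n = tau t n ^ (-α) / ((1 - α) * Real.Gamma (1 - α)) := by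
  have h0 := h.tau_pos hn1 hn
  unfold cKer
  rw [sub_self, Real.zero_rpow (by linarith), sub_zero, Gamma_two_sub hα1, ← tau,
    show 1 - α = -α + 1 by ring, Real.rpow_add_one h0.ne', mul_comm (tau t n ^ (-α)),
    mul_div_mul_left _ _ h0.ne']

lemma dKer_self (hα1 : α < 1) (h : CoarseningMesh t N) (hn1 : 1 ≤ n) (hn : n ≤ N) :
    dKer α t n n = α * tau t n ^ (-α) / Real.Gamma (3 - α) := by
  have h0 := h.tau_pos hn1 hn
  have hΓ : 0 < Real.Gamma (1 - α) := Real.Gamma_pos_of_pos (by linarith)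
  have h1 : 1 - α ≠ 0 := by linarith
  have h2 : 2 - α ≠ 0 := by linarith
  have e1 : tau t n ^ (1 - α) = tau t n ^ (-α) * tau t n := by
    rw [← Real.rpow_add_one h0.ne']; ring_nf
  have e2 : tau t n ^ (2 - α) = tau t n ^ (-α) * tau t n * tau t n := by
    rw [← Real.rpow_add_one h0.ne', ← Real.rpow_add_one h0.ne']; ring_nf
  unfold dKer
  rw [sub_self, Real.zero_rpow (by linarith), Real.zero_rpow (by linarith), sub_zero, add_zero,
    ← tau, e1, e2, Gamma_three_sub hα1, Gamma_two_sub hα1]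
  field_simp
  ring

lemma cTilde_of_lt (hα1 : α < 1) (h : CoarseningMesh t N) (hk : 1 ≤ k) (hkn : k < n)
    (hn : n ≤ N) :
    cTilde α t n k = localFunctional t (sKer α (t n)) k / Real.Gamma (1 - α) := by
  unfold cTilde localFunctional
  rw [if_neg (by omega)]
  by_cases hk1 : k = 1
  · subst hk1
    rw [if_pos rfl, if_pos rfl, cKer_eq hα1, dKer_eq hα1 h le_rfl hkn.le hn]
    ring
  · rw [if_neg hk1, if_neg hk1, if_neg hkn.ne, cKer_eq hα1, dKer_eq hα1 h hk hkn.le hn,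
      dKer_eq hα1 h (k := k - 1) (by omega) (by omega) hn]
    ring

/-- Twice the leading coefficient `1 - θ`, normalised by `1 - α`. -/
noncomputable def leadCoeff (α : ℝ) : ℝ := 2 * (1 - theta α) / (1 - α)

/-- The left side is exactly what the diagonal case of `JKer_succ_sub_le` consumes. The inputs are
$1-\frac7{10}\alpha\le2^{-\alpha}\le1-\frac\alpha2$ and $1/(1+\bar\rho)\le7/40$. -/
lemma le_leadCoeff (hα0 : 0 < α) (hα1 : α < 1) :
    1 + (1 - 2 ^ (-α)) / 2 ≤ leadCoeff α := by
  have hp1 : (2 : ℝ) ^ (-α) ≤ 1 - α / 2 := by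
    have := rpow_one_add_le_one_add_mul_self (s := -(1 / 2)) (by norm_num) hα0.le hα1.le
    rw [Real.rpow_neg (by norm_num), ← Real.inv_rpow (by norm_num)]
    norm_num at this ⊢
    linarith
  have hp2 : 1 - 7 / 10 * α ≤ (2 : ℝ) ^ (-α) := by
    rw [Real.rpow_def_of_pos (by norm_num)]
    have := Real.add_one_le_exp (Real.log 2 * -α)
    nlinarith [Real.log_two_lt_d9]
  have h2 : (2 : ℝ) ^ (1 - α) = 2 * 2 ^ (-α) := by
    rw [sub_eq_add_neg, Real.rpow_add (by norm_num), Real.rpow_one]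
  unfold leadCoeff theta
  rw [h2]
  generalize (2 : ℝ) ^ (-α) = p at *
  have h3 : 0 < 1 - α := by linarith
  have h4 : 0 < 2 - α := by linarith
  have hκ : 2 * p * α ^ 2 + α - 2 * α ^ 2 ≤ α * (1 + α) * (1 - α) := by
    nlinarith [mul_nonneg (sq_nonneg α) (sub_nonneg.2 hp1)]
  have hR : (2 * p * α ^ 2 + α - 2 * α ^ 2) / (1 + rhoBar) ≤
      α * (1 + α) * (1 - α) * (7 / 40) := by
    unfold rhoBar
    rw [div_le_iff₀ (by norm_num)]
    have : 0 ≤ α * (1 + α) * (1 - α) := by positivity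
    nlinarith
  have hR0 : (1 + rhoBar) ≠ 0 := by unfold rhoBar; norm_num
  rw [le_div_iff₀ h3]
  have e : 2 * (1 - (1 / (2 - α) + (2 * p * α ^ 2 + α - 2 * α ^ 2) /
      (2 * (2 - α) * (1 + rhoBar)))) =
      (2 * (1 - α) - (2 * p * α ^ 2 + α - 2 * α ^ 2) / (1 + rhoBar)) / (2 - α) := by
    field_simp
    ring
  rw [e, le_div_iff₀ h4]
  have h5 : (1 + (1 - p) / 2) * (2 - α) ≤ 2 - α * (1 + α) * (7 / 40) := by
    have : (1 + (1 - p) / 2) * (2 - α) ≤ (1 + 7 / 20 * α) * (2 - α) :=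
      mul_le_mul_of_nonneg_right (by linarith) h4.le
    nlinarith
  nlinarith [mul_le_mul_of_nonneg_left h5 h3.le]

lemma one_le_leadCoeff (hα0 : 0 < α) (hα1 : α < 1) : 1 ≤ leadCoeff α := by
  have h : (2 : ℝ) ^ (-α) ≤ 1 := Real.rpow_le_one_of_one_le_of_nonpos (by norm_num) (by linarith)
  linarith [le_leadCoeff hα0 hα1]

/-! ### Monotonicity of the auxiliary kernels -/

lemma JKer_of_lt (hα1 : α < 1) (h : CoarseningMesh t N) (hk : 1 ≤ k) (hkn : k < n)
    (hn : n ≤ N) :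
    JKer α t n k = localFunctional t (sKer α (t n)) k / Real.Gamma (1 - α) := by
  rw [JKer, if_neg hkn.ne, cTilde_of_lt hα1 h hk hkn hn]

lemma JKer_self (hα1 : α < 1) (h : CoarseningMesh t N) (hn2 : 2 ≤ n) (hn : n ≤ N) :
    JKer α t n n = (leadCoeff α * tau t n ^ (-α) +
      2 * (1 / (rho t n * (1 + rho t n)) *
        skew (sKer α (t n)) (t (n - 1 - 1)) (t (n - 1)))) / Real.Gamma (1 - α) := by
  rw [JKer, if_pos rfl, cTilde, if_neg (by omega), if_neg (by omega), if_pos rfl,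
    cKer_self hα1 h (by omega) hn, dKer_eq hα1 h (by omega) (by omega) hn, leadCoeff]
  have hΓ : 0 < Real.Gamma (1 - α) := Real.Gamma_pos_of_pos (by linarith)
  have h1 : 1 - α ≠ 0 := by linarith
  field_simp

lemma JKer_one_one (hα1 : α < 1) (h : CoarseningMesh t N) (hn : 1 ≤ N) :
    JKer α t 1 1 = leadCoeff α * tau t 1 ^ (-α) / Real.Gamma (1 - α) := by
  rw [JKer, if_pos rfl, cTilde, if_pos rfl, cKer_self hα1 h le_rfl hn, leadCoeff]
  have hΓ : 0 < Real.Gamma (1 - α) := Real.Gamma_pos_of_pos (by linarith)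
  have h1 : 1 - α ≠ 0 := by linarith
  field_simp

lemma skew_sKer_nonneg (hα0 : 0 < α) (h : CoarseningMesh t N) (hk : 1 ≤ k) (hkn : k < n)
    (hn : n ≤ N) : 0 ≤ skew (sKer α (t n)) (t (k - 1)) (t k) := by
  have hsub : Set.Icc (t (k - 1)) (t k) ⊆ Set.Iio (t n) := fun s hs => hs.2.trans_lt (h.lt hkn hn)
  exact skew_nonneg (h.lt (by omega) (by omega)) (continuousOn_sKer.mono hsub)
    ((monotoneOn_sKer hα0.le).mono hsub)

lemma JKer_one_nonneg (hα0 : 0 < α) (hα1 : α < 1) (h : CoarseningMesh t N) (hn1 : 1 ≤ n)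
    (hn : n ≤ N) : 0 ≤ JKer α t n 1 := by
  have hΓ : 0 < Real.Gamma (1 - α) := Real.Gamma_pos_of_pos (by linarith)
  rcases hn1.lt_or_eq with hn2 | rfl
  · rw [JKer_of_lt hα1 h le_rfl hn2 hn]
    have h1 := h.lt hn2 hn
    have h2 := le_localFunctional h le_rfl (by omega) h1 continuousOn_sKer
      (monotoneOn_sKer (α := α) hα0.le)
    have h3 : 0 ≤ sKer α (t n) (t (1 - 1)) :=
      Real.rpow_nonneg (sub_nonneg.2 (h.lt (by omega) hn).le) _
    exact div_nonneg (h3.trans h2) hΓ.le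
  · rw [JKer_one_one hα1 h hn]
    have := one_le_leadCoeff hα0 hα1
    have := Real.rpow_nonneg (h.tau_pos le_rfl hn).le (-α)
    positivity

/-- The value of the singular kernel at the common node $t_k$ separates two neighbouring entries. -/
lemma JKer_le_succ (hα0 : 0 < α) (hα1 : α < 1) (h : CoarseningMesh t N) (hk : 1 ≤ k)
    (hkn : k < n) (hn : n ≤ N) : JKer α t n k ≤ JKer α t n (k + 1) := by
  have hΓ : 0 < Real.Gamma (1 - α) := Real.Gamma_pos_of_pos (by linarith)
  have h1 := localFunctional_le h hk (by omega) (h.lt hkn hn) continuousOn_sKer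
      (monotoneOn_sKer (α := α) hα0.le) (convexOn_sKer hα0.le)
  rw [JKer_of_lt hα1 h hk hkn hn]
  rcases (Nat.succ_le_of_lt hkn).lt_or_eq with hlt | heq
  · rw [JKer_of_lt hα1 h (by omega) hlt hn]
    exact div_le_div_of_nonneg_right (h1.trans (le_localFunctional h (by omega) (by omega)
      (h.lt hlt hn) continuousOn_sKer (monotoneOn_sKer hα0.le))) hΓ.le
  · obtain rfl : n = k + 1 := heq.symm
    rw [JKer_self hα1 h (by omega) hn]
    refine div_le_div_of_nonneg_right ?_ hΓ.le
    have h2 := skew_sKer_nonneg hα0 h hk hkn hn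
    have h3 := h.one_le_rho (k + 1) (by omega) hn
    have h4 : 0 ≤ 1 / (rho t (k + 1) * (1 + rho t (k + 1))) := by positivity
    have h5 := Real.rpow_nonneg (h.tau_pos (k := k + 1) (by omega) hn).le (-α)
    have h6 := le_mul_of_one_le_left h5 (one_le_leadCoeff hα0 hα1)
    have h7 : sKer α (t (k + 1)) (t k) = tau t (k + 1) ^ (-α) := rfl
    rw [h7] at h1
    simp only [Nat.add_sub_cancel]
    have := mul_nonneg h4 h2
    linarith

lemma localFunctional_sKer_sub (h : CoarseningMesh t N) (hk : 1 ≤ k)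
    (hkn : k < n) (hn : n + 1 ≤ N) :
    localFunctional t (powDiff 1 (t n) (t (n + 1)) α) k =
      localFunctional t (sKer α (t n)) k - localFunctional t (sKer α (t (n + 1))) k := by
  rw [← sKer_sub_eq_powDiff]
  exact localFunctional_sub h hk (by omega) (h.lt hkn (by omega)) continuousOn_sKer
    (continuousOn_sKer.mono (Set.Iio_subset_Iio (h.lt (Nat.lt_succ_self n) hn).le))

lemma JKer_one_le (hα0 : 0 < α) (hα1 : α < 1) (h : CoarseningMesh t N) (hn1 : 1 ≤ n)
    (hn : n + 1 ≤ N) : JKer α t (n + 1) 1 ≤ JKer α t n 1 := by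
  have hΓ : 0 < Real.Gamma (1 - α) := Real.Gamma_pos_of_pos (by linarith)
  rw [JKer_of_lt hα1 h le_rfl (by omega) hn]
  have hle := (h.lt (Nat.lt_succ_self n) hn).le
  rcases hn1.lt_or_eq with hn2 | rfl
  · rw [JKer_of_lt hα1 h le_rfl hn2 (by omega)]
    refine div_le_div_of_nonneg_right ?_ hΓ.le
    have h1 := h.lt hn2 (by omega)
    have h2 := le_localFunctional (φ := powDiff 1 (t n) (t (n + 1)) α) h le_rfl (by omega) h1
      (continuousOn_powDiff hle) (monotoneOn_powDiff le_rfl hle hα0.le)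
    rw [localFunctional_sKer_sub h le_rfl hn2 hn] at h2
    have h3 := powDiff_nonneg (c := 1) (s := t (1 - 1)) le_rfl hle hα0.le
      (h.lt (by omega) (by omega))
    linarith
  · rw [JKer_one_one hα1 h (by omega)]
    refine div_le_div_of_nonneg_right ?_ hΓ.le
    have h1 := localFunctional_le h le_rfl hn (h.lt (Nat.lt_succ_self 1) hn) continuousOn_sKer
      (monotoneOn_sKer (α := α) hα0.le) (convexOn_sKer hα0.le)
    have h2 : sKer α (t (1 + 1)) (t 1) = tau t 2 ^ (-α) := rfl
    have h3 : tau t 2 ^ (-α) ≤ tau t 1 ^ (-α) :=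
      Real.rpow_le_rpow_of_nonpos (h.tau_pos le_rfl (by omega)) (h.tau_le le_rfl hn) (by linarith)
    have h4 := le_mul_of_one_le_left (Real.rpow_nonneg (h.tau_pos le_rfl (by omega)).le (-α))
      (one_le_leadCoeff hα0 hα1)
    rw [h2] at h1
    linarith

/-- The decay estimate behind `JKer_succ_sub_le` at the last index. -/
lemma rpow_neg_sub_le {τ T : ℝ} (hα0 : 0 < α) (hτ : 0 < τ) (hT : τ ≤ T) :
    T ^ (-α) - (τ + T) ^ (-α) ≤ (1 - 2 ^ (-α)) * τ ^ (-α) := by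
  -- The left side decreases in $T$, and at $T=\tau$ it equals the right side.
  have h := monotoneOn_powDiff (c := 1) (x := 0) (y := τ) le_rfl hτ.le hα0.le
    (a := -T) (b := -τ) (by simp; linarith) (by simp; linarith) (by linarith)
  simp only [powDiff, one_mul, zero_add, sub_neg_eq_add] at h
  rw [← two_mul, Real.mul_rpow (by norm_num) hτ.le] at h
  linarith

/-- Off the diagonal, the difference of the level $n$ and level $n+1$ kernels at $t_k$ separates its
two functionals. For $k+1=n$ the bounds for the functionals add up to
$\tau_n^{-\alpha}+\frac12(\tau_{n+1}^{-\alpha}-(\tau_n+\tau_{n+1})^{-\alpha})$ plus a moment;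
`rpow_neg_sub_le` and `le_leadCoeff` handle the powers, and the moment is dominated by its level $n$
counterpart in $J^{(n)}_0$. -/
lemma JKer_succ_sub_le (hα0 : 0 < α) (hα1 : α < 1) (h : CoarseningMesh t N) (hk : 1 ≤ k)
    (hkn : k < n) (hn : n + 1 ≤ N) :
    JKer α t (n + 1) (k + 1) - JKer α t (n + 1) k ≤ JKer α t n (k + 1) - JKer α t n k := by
  have hΓ : 0 < Real.Gamma (1 - α) := Real.Gamma_pos_of_pos (by linarith)
  have hle := (h.lt (Nat.lt_succ_self n) hn).le
  rw [JKer_of_lt hα1 h (k := k + 1) (by omega) (by omega) hn,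
    JKer_of_lt hα1 h hk (by omega) hn, JKer_of_lt hα1 h hk (by omega) (by omega)]
  have h1 := localFunctional_le (φ := powDiff 1 (t n) (t (n + 1)) α) h hk (by omega)
    (h.lt hkn (by omega)) (continuousOn_powDiff hle) (monotoneOn_powDiff le_rfl hle hα0.le)
    (convexOn_powDiff le_rfl hle hα0.le)
  rw [localFunctional_sKer_sub h hk hkn hn] at h1
  rcases (Nat.succ_le_of_lt hkn).lt_or_eq with hlt | heq
  · rw [JKer_of_lt hα1 h (by omega) hlt (by omega), ← sub_div, ← sub_div]
    refine div_le_div_of_nonneg_right ?_ hΓ.le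
    have h2 := le_localFunctional (φ := powDiff 1 (t n) (t (n + 1)) α) h (k := k + 1) (by omega)
      (by omega) (h.lt hlt (by omega)) (continuousOn_powDiff hle)
      (monotoneOn_powDiff le_rfl hle hα0.le)
    rw [localFunctional_sKer_sub h (by omega) hlt hn, Nat.add_sub_cancel] at h2
    linarith
  · obtain rfl : n = k + 1 := heq.symm
    rw [JKer_self hα1 h (by omega) (by omega), ← sub_div, ← sub_div]
    refine div_le_div_of_nonneg_right ?_ hΓ.le
    have hltk : t k < t (k + 1) := h.lt hkn (by omega)
    have hltk' : t (k + 1) < t (k + 1 + 1) := h.lt (by omega) hn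
    have hsub : Set.Icc (t k) (t (k + 1)) ⊆ Set.Iio (t (k + 1 + 1)) :=
      fun s hs => hs.2.trans_lt hltk'
    have hsub' : Set.Icc (t (k - 1)) (t k) ⊆ Set.Iio (t (k + 1)) := fun s hs => hs.2.trans_lt hltk
    have hlt0 : t (k - 1) < t k := h.lt (by omega) (by omega)
    have h2 := avg_le (φ := sKer α (t (k + 1 + 1))) hltk (continuousOn_sKer.mono hsub)
      ((convexOn_sKer hα0.le).subset hsub (convex_Icc _ _))
    have h3 := skew_nonneg (φ := sKer α (t (k + 1 + 1))) hltk (continuousOn_sKer.mono hsub)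
      ((monotoneOn_sKer hα0.le).mono hsub)
    have h4 := skew_nonneg (φ := powDiff 1 (t (k + 1)) (t (k + 1 + 1)) α) hlt0
      ((continuousOn_powDiff hle).mono hsub') ((monotoneOn_powDiff le_rfl hle hα0.le).mono hsub')
    rw [← sKer_sub_eq_powDiff, skew_sub
      (ContinuousOn.intervalIntegrable_of_Icc hlt0.le (continuousOn_sKer.mono hsub'))
      (ContinuousOn.intervalIntegrable_of_Icc hlt0.le
        (continuousOn_sKer.mono (hsub'.trans (Set.Iio_subset_Iio hle))))] at h4
    have h5 := skew_sKer_nonneg hα0 h hk (n := k + 1) (by omega) (by omega)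
    have hy := h.one_le_rho (k + 1) (by omega) (by omega)
    have hz := h.one_le_rho (k + 1 + 1) (by omega) hn
    have hτ := h.tau_pos (k := k + 1) (by omega) (by omega)
    have h6 := rpow_neg_sub_le hα0 hτ (h.tau_le (k := k + 1 + 1) (by omega) hn)
    have h7 := mul_le_mul_of_nonneg_right (le_leadCoeff hα0 hα1)
      (Real.rpow_nonneg hτ.le (-α))
    have h8 : 0 ≤ 1 / (1 + rho t (k + 1 + 1)) * skew (sKer α (t (k + 1 + 1))) (t k) (t (k + 1)) :=
      by positivity
    have hyp : 0 ≤ 1 / (rho t (k + 1) * (1 + rho t (k + 1))) := by positivity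
    have h9 : 1 / (rho t (k + 1) * (1 + rho t (k + 1))) *
          skew (sKer α (t (k + 1 + 1))) (t (k - 1)) (t k) ≤
        2 * (1 / (rho t (k + 1) * (1 + rho t (k + 1))) *
          skew (sKer α (t (k + 1))) (t (k - 1)) (t k)) := by
      nlinarith [mul_nonneg hyp h4, mul_nonneg hyp h5]
    have e1 : sKer α (t (k + 1 + 1)) (t (k + 1)) = tau t (k + 1 + 1) ^ (-α) := rfl
    have e2 : sKer α (t (k + 1 + 1)) (t k) = (tau t (k + 1) + tau t (k + 1 + 1)) ^ (-α) := by
      simp only [sKer, tau, Nat.add_sub_cancel]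
      ring_nf
    have e3 : powDiff 1 (t (k + 1)) (t (k + 1 + 1)) α (t k) =
        tau t (k + 1) ^ (-α) - (tau t (k + 1) + tau t (k + 1 + 1)) ^ (-α) := by
      rw [← sKer_sub_eq_powDiff, ← e2]
      rfl
    rw [e1, e2] at h2
    rw [e3] at h1
    have e4 : localFunctional t (sKer α (t (k + 1 + 1))) (k + 1) =
        avg (sKer α (t (k + 1 + 1))) (t k) (t (k + 1)) +
          1 / (rho t (k + 1) * (1 + rho t (k + 1))) *
            skew (sKer α (t (k + 1 + 1))) (t (k - 1)) (t k) -
          1 / (1 + rho t (k + 1 + 1)) * skew (sKer α (t (k + 1 + 1))) (t k) (t (k + 1)) := by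
      rw [localFunctional, if_neg (by omega)]
      simp only [Nat.add_sub_cancel]
    rw [e4]
    simp only [Nat.add_sub_cancel] at h6 ⊢
    linarith

end kernels

/-! ### Summation by parts and the kernel energy -/

lemma sum_mul_sub_eq (a u : ℕ → ℝ) {m : ℕ} (hm : 1 ≤ m) :
    ∑ k ∈ Finset.Icc 1 m, a k * (u (k - 1) - u k) =
      a 1 * u 0 + ∑ j ∈ Finset.Icc 1 (m - 1), (a (j + 1) - a j) * u j - a m * u m := by
  induction m, hm using Nat.le_induction with
  | base => simp; ring
  | succ m hm ih =>
    obtain ⟨p, rfl⟩ : ∃ p, m = p + 1 := ⟨m - 1, by omega⟩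
    rw [Finset.sum_Icc_succ_top (by omega), ih, Nat.add_sub_cancel, Nat.add_sub_cancel,
      Finset.sum_Icc_succ_top (by omega)]
    ring

/-- The part of `G` that is built from the auxiliary kernels. -/
noncomputable def kernelEnergy (α : ℝ) (t w : ℕ → ℝ) (n : ℕ) : ℝ :=
  1 / 2 * ∑ j ∈ Finset.Icc 1 (n - 1), (JKer α t n (j + 1) - JKer α t n j) * (w n - w j) ^ 2 +
    1 / 2 * JKer α t n 1 * (w n - w 0) ^ 2

section energy

variable {α : ℝ} {t : ℕ → ℝ} {N n : ℕ}

lemma G_eq (α : ℝ) (t w : ℕ → ℝ) (n : ℕ) :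
    G α t w n = α * rho t (n + 1) ^ (2 - α / 2) * nabla w n ^ 2 /
      (2 * (1 + rho t (n + 1)) * tau t n ^ α * Real.Gamma (3 - α)) + kernelEnergy α t w n := by
  rw [G, kernelEnergy, add_assoc]

lemma kernelEnergy_nonneg (hα0 : 0 < α) (hα1 : α < 1) (h : CoarseningMesh t N) (hn1 : 1 ≤ n)
    (hn : n ≤ N) (w : ℕ → ℝ) : 0 ≤ kernelEnergy α t w n := by
  have h1 := JKer_one_nonneg hα0 hα1 h hn1 hn
  have h2 : 0 ≤ ∑ j ∈ Finset.Icc 1 (n - 1),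
      (JKer α t n (j + 1) - JKer α t n j) * (w n - w j) ^ 2 := by
    refine Finset.sum_nonneg fun j hj => mul_nonneg (sub_nonneg.2 ?_) (sq_nonneg _)
    rw [Finset.mem_Icc] at hj
    exact JKer_le_succ hα0 hα1 h hj.1 (by omega) hn
  unfold kernelEnergy
  positivity

/-- Twice the product of $\nabla_\tau w^k$ and $\nabla_\tau w^{n+1}$ is a difference in $k$ of
$(w^{n+1}-w^k)^2-(w^n-w^k)^2$, so Abel summation produces energies with the level $n+1$ weights.
Only the old energy must pass to level $n$ weights, which are larger. The doubling in $J_0$ makes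
the diagonal term fit. -/
lemma kernelEnergy_sub_le (hα0 : 0 < α) (hα1 : α < 1) (h : CoarseningMesh t N) (hn1 : 1 ≤ n)
    (hn : n + 1 ≤ N) (w : ℕ → ℝ) :
    kernelEnergy α t w (n + 1) - kernelEnergy α t w n ≤
      (∑ k ∈ Finset.Icc 1 (n + 1), cTilde α t (n + 1) k * nabla w k) * nabla w (n + 1) := by
  set D := w (n + 1) - w n with hD
  have hJ : ∀ k ∈ Finset.Icc 1 n, cTilde α t (n + 1) k * nabla w k * (2 * D) =
      JKer α t (n + 1) k * (((w (n + 1) - w (k - 1)) ^ 2 - (w n - w (k - 1)) ^ 2) -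
        ((w (n + 1) - w k) ^ 2 - (w n - w k) ^ 2)) := by
    intro k hk
    rw [Finset.mem_Icc] at hk
    rw [JKer, if_neg (by omega), nabla]
    ring
  have hJn : 2 * cTilde α t (n + 1) (n + 1) = JKer α t (n + 1) (n + 1) := by
    rw [JKer, if_pos rfl]
  have hsum : (∑ k ∈ Finset.Icc 1 n, cTilde α t (n + 1) k * nabla w k) * (2 * D) =
      JKer α t (n + 1) 1 * ((w (n + 1) - w 0) ^ 2 - (w n - w 0) ^ 2) +
        ∑ j ∈ Finset.Icc 1 (n - 1), (JKer α t (n + 1) (j + 1) - JKer α t (n + 1) j) *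
          ((w (n + 1) - w j) ^ 2 - (w n - w j) ^ 2) - JKer α t (n + 1) n * D ^ 2 := by
    rw [Finset.sum_mul, Finset.sum_congr rfl hJ,
      sum_mul_sub_eq _ (fun k => (w (n + 1) - w k) ^ 2 - (w n - w k) ^ 2) hn1]
    ring
  have hE : 2 * kernelEnergy α t w (n + 1) =
      ∑ j ∈ Finset.Icc 1 (n - 1), (JKer α t (n + 1) (j + 1) - JKer α t (n + 1) j) *
        (w (n + 1) - w j) ^ 2 + (JKer α t (n + 1) (n + 1) - JKer α t (n + 1) n) * D ^ 2 +
      JKer α t (n + 1) 1 * (w (n + 1) - w 0) ^ 2 := by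
    obtain ⟨p, rfl⟩ : ∃ p, n = p + 1 := ⟨n - 1, by omega⟩
    rw [kernelEnergy, Nat.add_sub_cancel, Nat.add_sub_cancel, Finset.sum_Icc_succ_top (by omega)]
    ring
  have hold : ∑ j ∈ Finset.Icc 1 (n - 1), (JKer α t (n + 1) (j + 1) - JKer α t (n + 1) j) *
        (w n - w j) ^ 2 + JKer α t (n + 1) 1 * (w n - w 0) ^ 2 ≤ 2 * kernelEnergy α t w n := by
    have h1 : ∑ j ∈ Finset.Icc 1 (n - 1), (JKer α t (n + 1) (j + 1) - JKer α t (n + 1) j) *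
        (w n - w j) ^ 2 ≤ ∑ j ∈ Finset.Icc 1 (n - 1), (JKer α t n (j + 1) - JKer α t n j) *
        (w n - w j) ^ 2 := by
      refine Finset.sum_le_sum fun j hj => ?_
      rw [Finset.mem_Icc] at hj
      exact mul_le_mul_of_nonneg_right
        (JKer_succ_sub_le hα0 hα1 h hj.1 (by omega) hn) (sq_nonneg _)
    have h2 := mul_le_mul_of_nonneg_right (JKer_one_le hα0 hα1 h hn1 hn) (sq_nonneg (w n - w 0))
    unfold kernelEnergy
    linarith
  have hsplit : ∑ j ∈ Finset.Icc 1 (n - 1), (JKer α t (n + 1) (j + 1) - JKer α t (n + 1) j) *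
      ((w (n + 1) - w j) ^ 2 - (w n - w j) ^ 2) =
      ∑ j ∈ Finset.Icc 1 (n - 1), (JKer α t (n + 1) (j + 1) - JKer α t (n + 1) j) *
        (w (n + 1) - w j) ^ 2 -
      ∑ j ∈ Finset.Icc 1 (n - 1), (JKer α t (n + 1) (j + 1) - JKer α t (n + 1) j) *
        (w n - w j) ^ 2 := by
    simp only [mul_sub, Finset.sum_sub_distrib]
  have hnab : nabla w (n + 1) = D := rfl
  rw [Finset.sum_Icc_succ_top (by omega), hnab]
  rw [hsplit] at hsum
  linear_combination (1 / 2) * hold + (1 / 2) * hE - (1 / 2) * hsum - (1 / 2) * D ^ 2 * hJn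

/-! ### Splitting the L2 operator and the energy inequality -/

lemma BKer_self (hn : 2 ≤ n) : BKer α t n n =
    cTilde α t n n + theta α * cKer α t n n + rho t n / (1 + rho t n) * dKer α t n n := by
  rw [BKer, cTilde, if_neg (by omega), if_pos rfl, if_neg (by omega), if_neg (by omega), if_pos rfl]
  ring

lemma BKer_pred (hn : 1 ≤ n) : BKer α t (n + 1) n =
    cTilde α t (n + 1) n - rho t (n + 1) ^ 2 / (1 + rho t (n + 1)) * dKer α t (n + 1) (n + 1) := by
  by_cases h1 : n = 1
  · subst h1
    simp [BKer, cTilde]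
    ring
  · simp [BKer, cTilde, h1, show n ≠ 0 by omega, show n + 1 - 2 = n - 1 by omega, div_eq_mul_inv]
    ring

lemma BKer_of_lt {k : ℕ} (hk : 1 ≤ k) (hkn : k < n) : BKer α t (n + 1) k =
    cTilde α t (n + 1) k := by
  by_cases h1 : k = 1
  · simp [BKer, cTilde, h1, show n ≠ 0 by omega, show n ≠ 1 by omega]
    ring
  · simp [BKer, cTilde, h1, show n ≠ 0 by omega, show n ≠ 1 by omega, show k ≠ n + 1 by omega,
      show k ≠ n by omega, div_eq_mul_inv]
    ring

lemma caputoL2_eq (hn : 1 ≤ n) (w : ℕ → ℝ) : caputoL2 α t w (n + 1) =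
    ∑ k ∈ Finset.Icc 1 (n + 1), cTilde α t (n + 1) k * nabla w k +
      (theta α * cKer α t (n + 1) (n + 1) +
        rho t (n + 1) / (1 + rho t (n + 1)) * dKer α t (n + 1) (n + 1)) * nabla w (n + 1) -
      rho t (n + 1) ^ 2 / (1 + rho t (n + 1)) * dKer α t (n + 1) (n + 1) * nabla w n := by
  obtain ⟨p, rfl⟩ : ∃ p, n = p + 1 := ⟨n - 1, by omega⟩
  rw [caputoL2]
  simp only [Finset.sum_Icc_succ_top (show 1 ≤ p + 1 + 1 by omega),
    Finset.sum_Icc_succ_top (show 1 ≤ p + 1 by omega)]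
  have hs : ∑ k ∈ Finset.Icc 1 p, BKer α t (p + 1 + 1) k * nabla w k =
      ∑ k ∈ Finset.Icc 1 p, cTilde α t (p + 1 + 1) k * nabla w k := by
    refine Finset.sum_congr rfl fun k hk => ?_
    rw [Finset.mem_Icc] at hk
    rw [BKer_of_lt hk.1 (by omega)]
  rw [hs, BKer_self (by omega), BKer_pred (by omega)]
  ring

/-- The coefficient-wise Young inequality for the product of consecutive differences. -/
lemma sq_mul_rpow_mul_le {r σ x y : ℝ} (hr : 0 < r) (hσ : 0 < σ) :
    r ^ 2 * (r * σ) ^ (-α) * (y * x) ≤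
      r ^ (2 - α / 2) * ((r * σ) ^ (-α) * x ^ 2 + σ ^ (-α) * y ^ 2) / 2 := by
  have e1 : r ^ (2 - α / 2) = r ^ 2 * r ^ (-(α / 2)) := by
    rw [sub_eq_add_neg, Real.rpow_add hr, Real.rpow_two]
  have e2 : (r * σ) ^ (-α) = (r ^ (-(α / 2))) ^ 2 * σ ^ (-α) := by
    rw [Real.mul_rpow hr.le hσ.le, ← Real.rpow_two, ← Real.rpow_mul hr.le]
    ring_nf
  rw [e1, e2]
  have hh : 0 < r ^ (-(α / 2)) := Real.rpow_pos_of_pos hr _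
  have hS : 0 < σ ^ (-α) := Real.rpow_pos_of_pos hσ _
  generalize r ^ (-(α / 2)) = h at *
  generalize σ ^ (-α) = S at *
  -- This is twice the gap. The exponent $2-\alpha/2$ is the one that completes the square.
  have : 0 ≤ r ^ 2 * h * S * (h * x - y) ^ 2 := by positivity
  linarith

lemma G_nonneg (hα0 : 0 < α) (hα1 : α < 1) (h : CoarseningMesh t N) (hn1 : 1 ≤ n) (hn : n ≤ N)
    (hρ : 0 ≤ rho t (n + 1)) (w : ℕ → ℝ) : 0 ≤ G α t w n := by
  have h1 := kernelEnergy_nonneg hα0 hα1 h hn1 hn w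
  have h2 := h.tau_pos hn1 hn
  have h3 : 0 < Real.Gamma (3 - α) := Real.Gamma_pos_of_pos (by linarith)
  rw [G_eq]
  positivity

lemma G_sub_add_le_caputoL2_mul (hα0 : 0 < α) (hα1 : α < 1) (h : CoarseningMesh t N)
    (hn1 : 1 ≤ n) (hn : n + 1 ≤ N) (w : ℕ → ℝ) :
    G α t w (n + 1) - G α t w n + q (rho t (n + 1)) (rho t (n + 1 + 1)) α *
      nabla w (n + 1) ^ 2 / (2 * tau t (n + 1) ^ α * Real.Gamma (3 - α)) ≤
      caputoL2 α t w (n + 1) * nabla w (n + 1) := by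
  have hE := kernelEnergy_sub_le hα0 hα1 h hn1 hn w
  have hσ := h.tau_pos hn1 (by omega)
  have hτ := h.tau_pos (k := n + 1) (by omega) hn
  have hr : 0 < rho t (n + 1) := zero_lt_one.trans_le (h.one_le_rho (n + 1) (by omega) hn)
  have hY := sq_mul_rpow_mul_le (α := α) (x := nabla w (n + 1)) (y := nabla w n) hr hσ
  have hτe : tau t (n + 1) = rho t (n + 1) * tau t n := h.tau_eq (by omega) hn
  rw [← hτe] at hY
  have hM : 0 < Real.Gamma (1 - α) := Real.Gamma_pos_of_pos (by linarith)
  have hΓ : 0 < Real.Gamma (3 - α) := Real.Gamma_pos_of_pos (by linarith)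
  have hc : cKer α t (n + 1) (n + 1) =
      (2 - α) * tau t (n + 1) ^ (-α) / Real.Gamma (3 - α) := by
    rw [cKer_self hα1 h (by omega) hn, Gamma_three_sub hα1,
      mul_div_mul_left _ _ (by linarith : 2 - α ≠ 0)]
  rw [caputoL2_eq hn1, hc, dKer_self hα1 h (by omega) hn, G_eq, G_eq, q]
  have hY' := mul_le_mul_of_nonneg_left hY
    (by positivity : 0 ≤ α / ((1 + rho t (n + 1)) * Real.Gamma (3 - α)))
  have hP := (Real.rpow_pos_of_pos hτ α).ne'
  have hQ := (Real.rpow_pos_of_pos hσ α).ne'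
  rw [Real.rpow_neg hτ.le, Real.rpow_neg hσ.le] at hY'
  rw [Real.rpow_neg hτ.le]
  generalize tau t (n + 1) ^ α = P at *
  generalize tau t n ^ α = Q at *
  generalize rho t (n + 1) ^ (2 - α / 2) = R at *
  generalize rho t (n + 1 + 1) ^ (2 - α / 2) = R' at *
  generalize Real.Gamma (3 - α) = Γ at *
  simp only [div_eq_mul_inv, mul_inv] at hY' ⊢
  -- The square of $\nabla_\tau w^n$ from Young's inequality is the first term of `G` at level $n$;
  -- all squares of $\nabla_\tau w^{n+1}$ make up `q` and the first term of `G` at level $n+1$.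
  linear_combination hE + hY'

end energy

/-! ### Numerical positivity at $\bar\rho$ -/

lemma rhoBar_def : rhoBar = 4.7476114 := rfl

set_option exponentiation.threshold 1000 in
/-- `log ρ̄` to five digits. -/
lemma log_rhoBar_bounds :
    581 / 373 ≤ Real.log rhoBar ∧ Real.log rhoBar ≤ 662 / 425 := by
  have hR : (0 : ℝ) < rhoBar := by unfold rhoBar; norm_num
  -- A rational bound on the logarithm is a comparison of integer powers of $e$ and $\bar\rho$.
  have hlow : Real.exp 1 ^ 581 ≤ rhoBar ^ 373 :=
    (pow_le_pow_left₀ (Real.exp_pos 1).le Real.exp_one_lt_d9.le 581).trans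
      (by unfold rhoBar; norm_num)
  have hup : rhoBar ^ 425 ≤ Real.exp 1 ^ 662 :=
    le_trans (by unfold rhoBar; norm_num)
      (pow_le_pow_left₀ (by norm_num) Real.exp_one_gt_d9.le 662)
  have h1 := Real.log_le_log (by positivity) hlow
  have h2 := Real.log_le_log (by positivity) hup
  rw [Real.log_pow, Real.log_pow, Real.log_exp] at h1 h2
  push_cast at h1 h2
  constructor <;> linarith

lemma rpow_natCast_div_pow {x : ℝ} (hx : 0 ≤ x) (m : ℕ) {n : ℕ} (hn : n ≠ 0) :
    (x ^ ((m : ℝ) / n)) ^ n = x ^ m := by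
  rw [← Real.rpow_natCast, ← Real.rpow_mul hx, div_mul_cancel₀ _ (by positivity),
    Real.rpow_natCast]

lemma rpow_natCast_div_le {x u : ℝ} (hx : 0 ≤ x) (hu : 0 ≤ u) {m n : ℕ} (hn : n ≠ 0)
    (h : x ^ m ≤ u ^ n) : x ^ ((m : ℝ) / n) ≤ u := by
  rw [← pow_le_pow_iff_left₀ (Real.rpow_nonneg hx _) hu hn, rpow_natCast_div_pow hx m hn]
  exact h

lemma le_rpow_natCast_div {x u : ℝ} (hx : 0 ≤ x) (hu : 0 ≤ u) {m n : ℕ} (hn : n ≠ 0)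
    (h : u ^ n ≤ x ^ m) : u ≤ x ^ ((m : ℝ) / n) := by
  rw [← pow_le_pow_iff_left₀ hu (Real.rpow_nonneg hx _) hn, rpow_natCast_div_pow hx m hn]
  exact h

set_option exponentiation.threshold 1000 in
-- The exponent is $2-a/2$ at $a=167/203$. The upper bound enters the value of `rootFun` and must be
-- sharp; the lower one serves only the slope.
lemma rhoBar_rpow_bounds :
    11.87669 ≤ rhoBar ^ (645 / 406 : ℝ) ∧ rhoBar ^ (645 / 406 : ℝ) ≤ 11.876699430 := by
  have hR : (0 : ℝ) ≤ rhoBar := by unfold rhoBar; norm_num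
  constructor
  · exact_mod_cast le_rpow_natCast_div (m := 645) (n := 406) (u := 11.87669) hR (by norm_num)
      (by norm_num) (by unfold rhoBar; norm_num)
  · exact_mod_cast rpow_natCast_div_le (m := 645) (n := 406) (u := 11.876699430) hR (by norm_num)
      (by norm_num) (by unfold rhoBar; norm_num)

set_option exponentiation.threshold 1000 in
lemma two_rpow_neg_bounds :
    0.56539847 ≤ (2 : ℝ) ^ (-(167 / 203) : ℝ) ∧ (2 : ℝ) ^ (-(167 / 203) : ℝ) ≤ 0.5654 := by
  have e : (2 : ℝ) ^ (-(167 / 203) : ℝ) = (1 / 2) ^ ((167 : ℕ) / (203 : ℕ) : ℝ) := by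
    rw [one_div, Real.inv_rpow (by norm_num), Real.rpow_neg (by norm_num)]
    norm_num
  rw [e]
  constructor
  · exact le_rpow_natCast_div (by norm_num) (by norm_num) (by norm_num) (by norm_num)
  · exact rpow_natCast_div_le (by norm_num) (by norm_num) (by norm_num) (by norm_num)

lemma hasDerivAt_rootFun {r a : ℝ} (hr : 0 < r) (ha : a ≠ 0) :
    HasDerivAt (fun a => rootFun r a)
      (-(1 + r) / a ^ 2 + Real.log r / 2 * r ^ (2 - a / 2) +
        (2 : ℝ) ^ (-a) * (1 - Real.log 2 * a) - 1) a := by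
  have h1 : HasDerivAt (fun a : ℝ => (1 + r) / a) (-(1 + r) / a ^ 2) a := by
    have := (hasDerivAt_inv ha).const_mul (1 + r)
    exact this.congr_deriv (by ring)
  have h2 : HasDerivAt (fun a : ℝ => r ^ (2 - a / 2))
      (-(Real.log r / 2 * r ^ (2 - a / 2))) a := by
    have := (((hasDerivAt_id a).div_const 2).const_sub 2).const_rpow hr
    exact this.congr_deriv (by simp only [id]; ring)
  have h3 : HasDerivAt (fun a : ℝ => (2 : ℝ) ^ (-a) * a)
      ((2 : ℝ) ^ (-a) * (1 - Real.log 2 * a)) a := by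
    have := ((hasDerivAt_id a).neg.const_rpow (by norm_num : (0 : ℝ) < 2)).mul (hasDerivAt_id a)
    exact this.congr_deriv (by simp only [id, Pi.neg_apply]; ring)
  exact (((((h1.add_const r).sub h2).add h3).add_const (1 / 2)).sub (hasDerivAt_id a)).congr_deriv
    (by ring)

/-- The second derivative of `rootFun rhoBar` is at least one. -/
lemma one_le_deriv_two_rootFun {a : ℝ} (ha0 : 0 < a) (ha1 : a < 1) :
    1 ≤ 2 * (1 + rhoBar) / a ^ 3 - Real.log rhoBar ^ 2 / 4 * rhoBar ^ (2 - a / 2) +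
      (2 : ℝ) ^ (-a) * (-2 * Real.log 2 + Real.log 2 ^ 2 * a) := by
  have hR : (1 : ℝ) < rhoBar := by unfold rhoBar; norm_num
  obtain ⟨hL1, hL2⟩ := log_rhoBar_bounds
  have hp0 : 0 ≤ (2 : ℝ) ^ (-a) := by positivity
  have hp1 : (2 : ℝ) ^ (-a) ≤ 1 :=
    Real.rpow_le_one_of_one_le_of_nonpos (by norm_num) (by linarith)
  have hl0 : 0 < Real.log 2 := Real.log_pos (by norm_num)
  have hlast : -1.3864 ≤ (2 : ℝ) ^ (-a) * (-2 * Real.log 2 + Real.log 2 ^ 2 * a) := by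
    nlinarith [Real.log_two_lt_d9, mul_nonneg hp0 (by positivity : 0 ≤ Real.log 2 ^ 2 * a),
      mul_le_mul_of_nonneg_right hp1 hl0.le]
  have hL : Real.log rhoBar ^ 2 / 4 ≤ 0.607 := by nlinarith
  have hE0 : 0 ≤ rhoBar ^ (2 - a / 2) := Real.rpow_nonneg (by linarith) _
  have hmid := mul_le_mul_of_nonneg_right hL hE0
  have ha3 : 0 < a ^ 3 := by positivity
  -- For small $a$ the term in $a^{-3}$ is large; near $1$ the exponent $2-a/2$ is at most $5/3$.
  rcases le_total a 0.85 with h | h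
  · have hE : rhoBar ^ (2 - a / 2) ≤ rhoBar ^ (2 : ℝ) :=
      Real.rpow_le_rpow_of_exponent_le hR.le (by linarith)
    have hE2 : rhoBar ^ (2 : ℝ) ≤ 22.6 := by
      rw [Real.rpow_two]
      unfold rhoBar
      norm_num
    have h3 : a ^ 3 ≤ 0.85 ^ 3 := pow_le_pow_left₀ ha0.le h 3
    have h1 : 18 ≤ 2 * (1 + rhoBar) / a ^ 3 := by
      rw [le_div_iff₀ ha3]
      unfold rhoBar
      norm_num at h3 ⊢
      linarith
    linarith
  · have hE : rhoBar ^ (2 - a / 2) ≤ rhoBar ^ ((5 : ℕ) / (3 : ℕ) : ℝ) :=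
      Real.rpow_le_rpow_of_exponent_le hR.le (by norm_num at h ⊢; linarith)
    have hE2 : rhoBar ^ ((5 : ℕ) / (3 : ℕ) : ℝ) ≤ 13.5 :=
      rpow_natCast_div_le (by linarith) (by norm_num) (by norm_num) (by unfold rhoBar; norm_num)
    have h3 : a ^ 3 ≤ 1 := pow_le_one₀ ha0.le ha1.le
    have h1 : 11.49 ≤ 2 * (1 + rhoBar) / a ^ 3 := by
      rw [le_div_iff₀ ha3]
      unfold rhoBar
      norm_num at h3 ⊢
      linarith
    linarith

lemma hasDerivAt_deriv_rootFun {r a : ℝ} (hr : 0 < r) (ha : a ≠ 0) :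
    HasDerivAt (fun a => -(1 + r) / a ^ 2 + Real.log r / 2 * r ^ (2 - a / 2) +
        (2 : ℝ) ^ (-a) * (1 - Real.log 2 * a) - 1)
      (2 * (1 + r) / a ^ 3 - Real.log r ^ 2 / 4 * r ^ (2 - a / 2) +
      (2 : ℝ) ^ (-a) * (-2 * Real.log 2 + Real.log 2 ^ 2 * a)) a := by
  have h1 : HasDerivAt (fun a : ℝ => -(1 + r) / a ^ 2) (2 * (1 + r) / a ^ 3) a := by
    have := ((hasDerivAt_pow 2 a).inv (pow_ne_zero 2 ha)).const_mul (-(1 + r))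
    exact this.congr_deriv (by norm_num; field_simp; ring)
  have h2 : HasDerivAt (fun a : ℝ => Real.log r / 2 * r ^ (2 - a / 2))
      (-(Real.log r ^ 2 / 4 * r ^ (2 - a / 2))) a := by
    have := ((((hasDerivAt_id a).div_const 2).const_sub 2).const_rpow hr).const_mul
      (Real.log r / 2)
    exact this.congr_deriv (by simp only [id]; ring)
  have h3 : HasDerivAt (fun a : ℝ => (2 : ℝ) ^ (-a) * (1 - Real.log 2 * a))
      ((2 : ℝ) ^ (-a) * (-2 * Real.log 2 + Real.log 2 ^ 2 * a)) a := by
    have := ((hasDerivAt_id a).neg.const_rpow (by norm_num : (0 : ℝ) < 2)).mul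
      (((hasDerivAt_id a).const_mul (Real.log 2)).const_sub 1)
    exact this.congr_deriv (by simp only [id, Pi.neg_apply]; ring)
  exact (((h1.add h2).add h3).sub_const 1).congr_deriv (by ring)

/-- A convex function lies above its tangent lines. -/
lemma ConvexOn.add_mul_sub_le {S : Set ℝ} {f : ℝ → ℝ} {f' x y : ℝ} (hf : ConvexOn ℝ S f)
    (hx : x ∈ S) (hy : y ∈ S) (hd : HasDerivAt f f' x) : f x + f' * (y - x) ≤ f y := by
  rcases lt_trichotomy x y with h | rfl | h
  · have := hf.le_slope_of_hasDerivAt hx hy h hd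
    rw [slope_def_field, le_div_iff₀ (by linarith)] at this
    linarith
  · simp
  · have := hf.slope_le_of_hasDerivAt hy hx h hd
    rw [slope_def_field, div_le_iff₀ (by linarith)] at this
    linarith

/-- `rootFun rhoBar` is positive on `(0, 1)`; its minimum, attained close to `167 / 203`, is
less than `10⁻⁷`. -/
lemma rootFun_rhoBar_pos {α : ℝ} (hα0 : 0 < α) (hα1 : α < 1) : 0 < rootFun rhoBar α := by
  have hR : (0 : ℝ) < rhoBar := by unfold rhoBar; norm_num
  have hd : ∀ a ∈ Set.Ioo (0 : ℝ) 1,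
      HasDerivAt (fun a => rootFun rhoBar a - (a - 167 / 203) ^ 2 / 2)
        (-(1 + rhoBar) / a ^ 2 + Real.log rhoBar / 2 * rhoBar ^ (2 - a / 2) +
          (2 : ℝ) ^ (-a) * (1 - Real.log 2 * a) - 1 - (a - 167 / 203)) a := by
    intro a ha
    have h2 : HasDerivAt (fun a : ℝ => (a - 167 / 203) ^ 2 / 2) (a - 167 / 203) a :=
      ((((hasDerivAt_id a).sub_const (167 / 203)).pow 2).div_const 2).congr_deriv
        (by simp only [id]; ring)
    exact (hasDerivAt_rootFun hR ha.1.ne').sub h2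
  have hd2 : ∀ a ∈ Set.Ioo (0 : ℝ) 1,
      HasDerivAt (fun a => -(1 + rhoBar) / a ^ 2 + Real.log rhoBar / 2 * rhoBar ^ (2 - a / 2) +
          (2 : ℝ) ^ (-a) * (1 - Real.log 2 * a) - 1 - (a - 167 / 203))
        (2 * (1 + rhoBar) / a ^ 3 - Real.log rhoBar ^ 2 / 4 * rhoBar ^ (2 - a / 2) +
          (2 : ℝ) ^ (-a) * (-2 * Real.log 2 + Real.log 2 ^ 2 * a) - 1) a := fun a ha =>
    (hasDerivAt_deriv_rootFun hR ha.1.ne').sub ((hasDerivAt_id a).sub_const (167 / 203))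
  have hmono : MonotoneOn (fun a => -(1 + rhoBar) / a ^ 2 +
      Real.log rhoBar / 2 * rhoBar ^ (2 - a / 2) +
      (2 : ℝ) ^ (-a) * (1 - Real.log 2 * a) - 1 - (a - 167 / 203)) (Set.Ioo 0 1) := by
    refine monotoneOn_of_deriv_nonneg (convex_Ioo 0 1)
      (fun a ha => (hd2 a ha).continuousAt.continuousWithinAt) ?_ ?_
    · rw [interior_Ioo]
      exact fun a ha => (hd2 a ha).differentiableAt.differentiableWithinAt
    · rw [interior_Ioo]
      intro a ha
      rw [(hd2 a ha).deriv]
      linarith [one_le_deriv_two_rootFun ha.1 ha.2]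
  have hconv : ConvexOn ℝ (Set.Ioo 0 1)
      (fun a => rootFun rhoBar a - (a - 167 / 203) ^ 2 / 2) := by
    refine MonotoneOn.convexOn_of_deriv (convex_Ioo 0 1)
      (fun a ha => (hd a ha).continuousAt.continuousWithinAt) ?_ ?_
    · rw [interior_Ioo]
      exact fun a ha => (hd a ha).differentiableAt.differentiableWithinAt
    · rw [interior_Ioo]
      intro a ha b hb hab
      rw [(hd a ha).deriv, (hd b hb).deriv]
      exact hmono ha hb hab
  have ha0 : (167 / 203 : ℝ) ∈ Set.Ioo (0 : ℝ) 1 := by norm_num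
  have key := hconv.add_mul_sub_le ha0 ⟨hα0, hα1⟩ (hd _ ha0)
  obtain ⟨hL1, hL2⟩ := log_rhoBar_bounds
  obtain ⟨hE1, hE2⟩ := rhoBar_rpow_bounds
  obtain ⟨hp1, hp2⟩ := two_rpow_neg_bounds
  have he : (2 : ℝ) - 167 / 203 / 2 = 645 / 406 := by norm_num
  have hval : 8e-8 ≤ rootFun rhoBar (167 / 203) := by
    unfold rootFun
    rw [he]
    rw [rhoBar_def] at hE2 ⊢
    norm_num at hE2 hp1 ⊢
    linarith
  have hder : |(-(1 + rhoBar) / (167 / 203) ^ 2 +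
      Real.log rhoBar / 2 * rhoBar ^ (2 - 167 / 203 / 2 : ℝ) +
      (2 : ℝ) ^ (-(167 / 203) : ℝ) * (1 - Real.log 2 * (167 / 203)) - 1 -
      (167 / 203 - 167 / 203))| ≤ 3e-4 := by
    rw [he, rhoBar_def]
    rw [rhoBar_def] at hL1 hL2 hE1 hE2
    have hLE1 := mul_le_mul hL1 hE1 (by norm_num) (by linarith)
    have hLE2 := mul_le_mul hL2 hE2 (by linarith) (by norm_num)
    have hlp1 := mul_le_mul Real.log_two_gt_d9.le hp1 (by norm_num)
      (Real.log_pos (by norm_num)).le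
    have hlp2 := mul_le_mul Real.log_two_lt_d9.le hp2 (by linarith) (by norm_num)
    generalize Real.log 4.7476114 = L at *
    generalize (4.7476114 : ℝ) ^ (645 / 406 : ℝ) = E at *
    generalize (2 : ℝ) ^ (-(167 / 203) : ℝ) = p at *
    generalize Real.log 2 = l at *
    norm_num at hLE1 hLE2 hlp1 hlp2 hp1 hp2
    rw [abs_le]
    constructor
    · norm_num
      linarith
    · norm_num
      linarith
  simp only [sub_self] at key hder
  generalize -(1 + rhoBar) / (167 / 203) ^ 2 +
      Real.log rhoBar / 2 * rhoBar ^ (2 - 167 / 203 / 2 : ℝ) +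
      (2 : ℝ) ^ (-(167 / 203) : ℝ) * (1 - Real.log 2 * (167 / 203)) - 1 - 0 = D at key hder
  obtain ⟨h1, h2⟩ := abs_le.1 hder
  -- The tangent bound leaves at least $8\cdot10^{-8}-D^2/2$, and $D^2/2\le4.5\cdot10^{-8}$.
  nlinarith [sq_nonneg (α - 167 / 203 + D)]

/-! ### Existence and uniqueness of the root -/

/-- This is concavity in $r$ between $0$ and $s$, with $\lambda=r/s$: the value at $r$ is at least
$\lambda$ times that at $s$ plus $1-\lambda$ times the positive value at $0$. -/
lemma rootFun_pos_of_lt {α r s : ℝ} (hα0 : 0 < α) (hα1 : α < 1) (hr : 0 < r) (hrs : r < s)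
    (hs : 0 ≤ rootFun s α) : 0 < rootFun r α := by
  have hs0 : 0 < s := hr.trans hrs
  have hl0 : 0 < r / s := div_pos hr hs0
  have hl1 : r / s < 1 := (div_lt_one hs0).2 hrs
  have hp : (1 / 2 : ℝ) < 2 ^ (-α) := by
    rw [one_div, ← Real.rpow_neg_one]
    exact Real.rpow_lt_rpow_of_exponent_lt (by norm_num) (by linarith)
  have hC : 0 < (2 : ℝ) ^ (-α) * α + 1 / 2 - α := by nlinarith
  have hpow : r ^ (2 - α / 2) ≤ r / s * s ^ (2 - α / 2) := by
    have h1 : (r / s) ^ (2 - α / 2) ≤ r / s := by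
      simpa using Real.rpow_le_rpow_of_exponent_ge hl0 hl1.le (by linarith : 1 ≤ 2 - α / 2)
    calc r ^ (2 - α / 2) = (r / s * s) ^ (2 - α / 2) := by rw [div_mul_cancel₀ _ hs0.ne']
      _ = (r / s) ^ (2 - α / 2) * s ^ (2 - α / 2) := Real.mul_rpow hl0.le hs0.le
      _ ≤ _ := mul_le_mul_of_nonneg_right h1 (Real.rpow_nonneg hs0.le _)
  have hr' : r = r / s * s := (div_mul_cancel₀ _ hs0.ne').symm
  unfold rootFun at hs ⊢
  generalize (2 : ℝ) ^ (-α) * α = C at *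
  have e : (1 + r) / α = r / s * ((1 + s) / α) + (1 - r / s) * (1 / α) := by
    field_simp
    ring
  have h2 := mul_nonneg hl0.le hs
  have h3 : 0 < (1 - r / s) * (1 / α + (C + 1 / 2 - α)) :=
    mul_pos (by linarith) (by positivity)
  linarith

lemma exists_rootFun_neg {α : ℝ} (hα0 : 0 < α) (hα1 : α < 1) :
    ∃ M, rhoBar ≤ M ∧ rootFun M α < 0 := by
  have hi : 1 ≤ 1 / α := (one_le_div hα0).2 hα1.le
  -- At $M=m^2$ the power is at least $m^3$, since $2-\alpha/2\ge3/2$, and $m^3=3m^2/\alpha+3m^2$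
  -- beats the linear terms.
  obtain ⟨m, hm⟩ : ∃ m : ℝ, m = 3 * (1 / α) + 3 := ⟨_, rfl⟩
  have hm6 : 6 ≤ m := by linarith
  refine ⟨m ^ 2, by unfold rhoBar; norm_num; nlinarith, ?_⟩
  have h1 : m ^ 3 ≤ (m ^ 2) ^ (2 - α / 2) := by
    have : m ^ 3 = (m ^ 2) ^ (3 / 2 : ℝ) := by
      rw [← Real.rpow_natCast m 2, ← Real.rpow_mul (by linarith), ← Real.rpow_natCast]
      norm_num
    rw [this]
    exact Real.rpow_le_rpow_of_exponent_le (by nlinarith) (by linarith)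
  have h2 : (2 : ℝ) ^ (-α) ≤ 1 :=
    Real.rpow_le_one_of_one_le_of_nonpos (by norm_num) (by linarith)
  have h3 : (2 : ℝ) ^ (-α) * α ≤ α := mul_le_of_le_one_left hα0.le h2
  have e : (1 + m ^ 2) / α = 1 / α + m ^ 2 * (1 / α) := by ring
  have h4 : 1 / α ≤ m ^ 2 * (1 / α) := le_mul_of_one_le_left (by linarith) (by nlinarith)
  have h5 : m ^ 3 = 3 * (m ^ 2 * (1 / α)) + 3 * m ^ 2 := by
    rw [pow_succ m 2]
    nth_rewrite 2 [hm]
    ring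
  unfold rootFun
  rw [e]
  nlinarith

lemma rhoStar_spec {α : ℝ} (hα0 : 0 < α) (hα1 : α < 1) :
    (0 < rhoStar α ∧ rootFun (rhoStar α) α = 0) ∧
      (∀ r : ℝ, 0 < r → rootFun r α = 0 → r = rhoStar α) ∧ rhoBar < rhoStar α := by
  have hR : (0 : ℝ) < rhoBar := by unfold rhoBar; norm_num
  have hpos := rootFun_rhoBar_pos hα0 hα1
  obtain ⟨M, hM, hneg⟩ := exists_rootFun_neg hα0 hα1
  have hcont : ContinuousOn (fun r => rootFun r α) (Set.Icc rhoBar M) := by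
    unfold rootFun
    have : ContinuousOn (fun r : ℝ => r ^ (2 - α / 2)) (Set.Icc rhoBar M) :=
      continuousOn_id.rpow_const fun r hr => Or.inl (hR.trans_le hr.1).ne'
    fun_prop
  obtain ⟨r, hr, hr0⟩ := intermediate_value_Icc' hM hcont ⟨hneg.le, hpos.le⟩
  have hrpos : 0 < r := hR.trans_le hr.1
  have huniq : ∀ s, 0 < s → rootFun s α = 0 → s = r := by
    intro s hs hs0
    rcases lt_trichotomy s r with h | h | h
    · exact absurd hs0 (rootFun_pos_of_lt hα0 hα1 hs h hr0.ge).ne'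
    · exact h
    · exact absurd hr0 (rootFun_pos_of_lt hα0 hα1 hrpos h hs0.ge).ne'
  have hstar : rhoStar α = r := by
    have : {s : ℝ | 0 < s ∧ rootFun s α = 0} = {r} := by
      ext s
      exact ⟨fun hs => huniq s hs.1 hs.2, fun hs => by rw [hs]; exact ⟨hrpos, hr0⟩⟩
    rw [rhoStar, this, csSup_singleton]
  rw [hstar]
  refine ⟨⟨hrpos, hr0⟩, huniq, lt_of_le_of_ne hr.1 ?_⟩
  rintro rfl
  exact hpos.ne' hr0

/- The ratio `rho t (N + 1)`, which enters only through `G` and `q` at the last level `n = N`, is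
represented by one further node `t (N + 1)`; it can be any number in `[1, rhoStar α]`. -/
theorem theorem2p6 (α : ℝ) (hα0 : 0 < α) (hα1 : α < 1) :
    ((0 < rhoStar α ∧ rootFun (rhoStar α) α = 0) ∧
      (∀ r : ℝ, 0 < r → rootFun r α = 0 → r = rhoStar α) ∧
      rhoBar < rhoStar α) ∧
    ∀ (N : ℕ) (t : ℕ → ℝ), t 0 = 0 → (∀ k < N, t k < t (k + 1)) →
      (∀ k, 2 ≤ k → k ≤ N + 1 → 1 ≤ rho t k ∧ rho t k ≤ rhoStar α) →
      ∀ w : ℕ → ℝ,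
        (∀ n, 1 ≤ n → n ≤ N → 0 ≤ G α t w n) ∧
        ∀ n, 2 ≤ n → n ≤ N →
          caputoL2 α t w n * nabla w n ≥
            G α t w n - G α t w (n - 1) +
              q (rho t n) (rho t (n + 1)) α * nabla w n ^ 2 /
                (2 * tau t n ^ α * Real.Gamma (3 - α)) := by
  refine ⟨rhoStar_spec hα0 hα1, fun N t _ ht hρ w => ?_⟩
  have h : CoarseningMesh t N := ⟨ht, fun k hk hkN => (hρ k hk (by omega)).1⟩
  refine ⟨fun n hn1 hn => G_nonneg hα0 hα1 h hn1 hn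
    (zero_le_one.trans (hρ (n + 1) (by omega) (by omega)).1) w, fun n hn2 hn => ?_⟩
  obtain ⟨m, rfl⟩ : ∃ m, n = m + 1 := ⟨n - 1, by omega⟩
  exact G_sub_add_le_caputoL2_mul hα0 hα1 h (by omega) hn w
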